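/- Let $\mathbb K$ be an algebraically closed field and let $A$ be a finite-dimensional $\mathbb K$-algebra. For a finite-dimensional $\mathbb K$-algebra $B$, let $\mathrm{mod}(B)$ denote the category of finite-dimensional left $B$-modules. A fully faithful exact functor $F:\mathrm{mod}(B)\to\mathrm{mod}(A)$, with $B$ a finite-dimensional $\mathbb K$-algebra, is called a *weakly homological embedding* (respectively, a *homological embedding*) if the induced maps $\mathrm{Ext}^i_B(X,Y)\to\mathrm{Ext}^i_A(F(X),F(Y))$ are isomorphisms for all $X,Y\in\mathrm{mod}(B)$ and for $i=1$ (respectively, for all $i>0$). Two such functors $F:\mathrm{mod}(B)\to\mathrm{mod}(A)$ and $F':\mathrm{mod}(B')\to\mathrm{mod}(A)$ are equivalent if there is an equivalence of categories $G:\mathrm{mod}(B)\to\mathrm{mod}(B')$ with $F'\circ G\cong F$. A full subcategory of $\mathrm{mod}(A)$ is *wide* if it contains $0$ and is closed under kernels, cokernels and extensions. A full subcategory $\mathcal W$ is *functorially finite* if for every $X\in\mathrm{mod}(A)$ there are objects $C_1,C_2\in\mathcal W$ and morphisms $g_1:X\to C_1$ and $g_2:C_2\to X$ such that every morphism from $X$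 to an object of $\mathcal W$ factors through $g_1$ and every morphism from an object of $\mathcal W$ to $X$ factors through $g_2$. A *ring epimorphism* $A\to B$ is a homomorphism of finite-dimensional $\mathbb K$-algebras that is an epimorphism in the category of rings. Two ring epimorphisms $f:A\to B$ and $f':A\to B'$ are equivalent if there is an isomorphism of $\mathbb K$-algebras $g:B'\to B$ with $g\circ f'=f$. Then there are one-to-one correspondences between 1. equivalence classes of weakly homological embeddings $\mathrm{mod}(B)\to\mathrm{mod}(A)$; 2. functorially finite wide subcategories of $\mathrm{mod}(A)$; 3. equivalence classes of ring epimorphisms $A\to B$ with $\mathrm{Tor}_1^A(B,B)=0$. More precisely, sending $F$ to its essential image $\mathrm{Im}(F)$ induces a bijection from (1) to (2), and sending $A\to B$ to its restriction functor $\mathrm{mod}(B)\to\mathrm{mod}(A)$ induces a bijection from (3) to (1). Moreover, the latter bijection restricts to a bijection between * (3') equivalence classes of ring epimorphisms $A\to B$ with $\mathrm{Tor}_i^A(B,B)=0$ for all $i>0$; and * (1') equivalence classes of homological embeddings $\mathrm{mod}(B)\to\mathrm{mod}(A)$. -/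

import Mathlib

open CategoryTheory CategoryTheory.Limits
open scoped TensorProduct

universe u

noncomputable section

namespace ModEmb

section Subcategories

variable {C : Type*} [Category* C]

/-- A full subcategory `W` of `C` is functorially finite if every object `X` of `C` has a left
`W`-approximation `g₁ : X ⟶ C₁` and a right `W`-approximation `g₂ : C₂ ⟶ X`. -/
def IsFunctoriallyFinite (W : ObjectProperty C) : Prop :=
  ∀ X : C,
    (∃ C₁, W C₁ ∧ ∃ g₁ : X ⟶ C₁, ∀ T, W T →
      Function.Surjective (fun h : C₁ ⟶ T => g₁ ≫ h)) ∧
    (∃ C₂, W C₂ ∧ ∃ g₂ : C₂ ⟶ X, ∀ T, W T →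
      Function.Surjective (fun h : T ⟶ C₂ => h ≫ g₂))

/-- A full subcategory is wide if it contains zero and is closed under kernels, cokernels and
extensions. (Being closed under all kernels, it is in particular closed under isomorphisms.) -/
structure IsWide [Preadditive C] (W : ObjectProperty C) : Prop where
  containsZero : W.ContainsZero
  kernels : W.IsClosedUnderKernels
  cokernels : W.IsClosedUnderCokernels
  extensions : W.IsClosedUnderExtensions

end Subcategories

section Embeddings

variable {C D : Type*} [Category* C] [Category* D] [Abelian C] [Abelian D]

/-- Fully faithful exact functors between abelian categories. -/
structure IsFullyFaithfulExact (F : C ⥤ D) : Prop where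
  full : F.Full
  faithful : F.Faithful
  preservesFiniteLimits : PreservesFiniteLimits F
  preservesFiniteColimits : PreservesFiniteColimits F

/-- An exact functor between abelian categories is additive. -/
lemma IsFullyFaithfulExact.additive {F : C ⥤ D} (h : IsFullyFaithfulExact F) : F.Additive := by
  have := h.preservesFiniteLimits
  have := preservesBinaryBiproducts_of_preservesBinaryProducts F
  exact Functor.additive_of_preservesBinaryBiproducts F

/-- The map `Ext^i_C(X, Y) → Ext^i_D(F X, F Y)` induced by the exact functor `F` is an isomorphism
for all `X` and `Y`. -/
def IsFullyFaithfulExact.ExtIso {F : C ⥤ D} (h : IsFullyFaithfulExact F) (i : ℕ) : Prop :=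
  haveI := h.additive
  haveI := h.preservesFiniteLimits
  haveI := h.preservesFiniteColimits
  letI := HasExt.standard C
  letI := HasExt.standard D
  ∀ X Y : C, Function.Bijective (F.mapExtAddHom X Y i)

/-- Weakly homological embeddings: fully faithful exact functors inducing isomorphisms on
`Ext^1`. -/
def IsWeaklyHomologicalEmbedding (F : C ⥤ D) : Prop :=
  ∃ h : IsFullyFaithfulExact F, h.ExtIso 1

/-- Homological embeddings: fully faithful exact functors inducing isomorphisms on `Ext^i` for all
`i > 0`. -/
def IsHomologicalEmbedding (F : C ⥤ D) : Prop :=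
  ∃ h : IsFullyFaithfulExact F, ∀ i : ℕ, 0 < i → h.ExtIso i

end Embeddings

section Tor

/-! ### The tensor product and `Tor` over a noncommutative ring

A right `A`-module is a module over `Aᵐᵒᵖ`, with `m · a = op a • m`. -/

variable (A : Type u) [Ring A]

/-- The subgroup of `M ⊗[ℤ] N` generated by the elements `(m · a) ⊗ n - m ⊗ (a · n)`, for a right
`A`-module `M` and a left `A`-module `N`. -/
def balancedRel (M N : Type u) [AddCommGroup M] [Module Aᵐᵒᵖ M] [AddCommGroup N] [Module A N] :
    AddSubgroup (M ⊗[ℤ] N) :=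
  AddSubgroup.closure {t | ∃ (m : M) (a : A) (n : N),
    t = (MulOpposite.op a • m) ⊗ₜ[ℤ] n - m ⊗ₜ[ℤ] (a • n)}

/-- The tensor product `M ⊗_A N` of a right `A`-module `M` and a left `A`-module `N`. -/
abbrev BalancedTensor (M N : Type u) [AddCommGroup M] [Module Aᵐᵒᵖ M] [AddCommGroup N]
    [Module A N] : Type u :=
  (M ⊗[ℤ] N) ⧸ balancedRel A M N

section map

variable {A} (M : Type u) {N N' : Type u} [AddCommGroup M] [Module Aᵐᵒᵖ M]
  [AddCommGroup N] [Module A N] [AddCommGroup N'] [Module A N']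

/-- The map `m ⊗ n ↦ m ⊗ g n` on the tensor products over `ℤ`. -/
def preTensorMap (g : N →ₗ[A] N') : M ⊗[ℤ] N →+ M ⊗[ℤ] N' :=
  (TensorProduct.map (LinearMap.id : M →ₗ[ℤ] M) g.toAddMonoidHom.toIntLinearMap).toAddMonoidHom

@[simp]
lemma preTensorMap_tmul (g : N →ₗ[A] N') (m : M) (n : N) :
    preTensorMap M g (m ⊗ₜ[ℤ] n) = m ⊗ₜ[ℤ] g n := rfl

lemma balancedRel_le_comap (g : N →ₗ[A] N') :
    balancedRel A M N ≤ (balancedRel A M N').comap (preTensorMap M g) := by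
  rw [balancedRel, AddSubgroup.closure_le]
  rintro _ ⟨m, a, n, rfl⟩
  refine AddSubgroup.subset_closure ⟨m, a, g n, ?_⟩
  rw [map_sub, preTensorMap_tmul, preTensorMap_tmul, map_smul]

/-- The map `M ⊗_A N → M ⊗_A N'`, `m ⊗ n ↦ m ⊗ g n`. -/
def BalancedTensor.map (g : N →ₗ[A] N') : BalancedTensor A M N →+ BalancedTensor A M N' :=
  QuotientAddGroup.map _ _ (preTensorMap M g) (balancedRel_le_comap M g)

variable {M} in
lemma BalancedTensor.hom_ext {P : Type*} [AddCommGroup P] {φ ψ : BalancedTensor A M N →+ P}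
    (h : ∀ (m : M) (n : N), φ (QuotientAddGroup.mk (m ⊗ₜ[ℤ] n)) =
      ψ (QuotientAddGroup.mk (m ⊗ₜ[ℤ] n))) : φ = ψ := by
  refine QuotientAddGroup.addMonoidHom_ext _ ?_
  ext x
  induction x with
  | zero => simp
  | tmul m n => exact h m n
  | add x y hx hy => rw [map_add, map_add, hx, hy]

@[simp]
lemma BalancedTensor.map_mk (g : N →ₗ[A] N') (m : M) (n : N) :
    BalancedTensor.map M g (QuotientAddGroup.mk (m ⊗ₜ[ℤ] n)) =
      QuotientAddGroup.mk (m ⊗ₜ[ℤ] g n) := rfl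

end map

variable {A}

/-- The functor `N ↦ M ⊗_A N` from left `A`-modules to abelian groups, for a right
`A`-module `M`. -/
def tensorFunctor (M : ModuleCat.{u} Aᵐᵒᵖ) : ModuleCat.{u} A ⥤ AddCommGrpCat.{u} where
  obj N := AddCommGrpCat.of (BalancedTensor A M N)
  map g := AddCommGrpCat.ofHom (BalancedTensor.map M g.hom)
  map_id N := by
    apply AddCommGrpCat.hom_ext
    exact BalancedTensor.hom_ext fun m n => rfl
  map_comp g h := by
    apply AddCommGrpCat.hom_ext
    exact BalancedTensor.hom_ext fun m n => rfl

instance (M : ModuleCat.{u} Aᵐᵒᵖ) : (tensorFunctor M).Additive where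
  map_add {N N' g h} := by
    apply AddCommGrpCat.hom_ext
    refine BalancedTensor.hom_ext fun m n => ?_
    change QuotientAddGroup.mk (m ⊗ₜ[ℤ] (g.hom n + h.hom n)) =
      QuotientAddGroup.mk (m ⊗ₜ[ℤ] g.hom n) + QuotientAddGroup.mk (m ⊗ₜ[ℤ] h.hom n)
    rw [TensorProduct.tmul_add, QuotientAddGroup.mk_add]

/-- `Tor_i^A(M, N)`, as the `i`-th left derived functor of `M ⊗_A -` evaluated at `N`. -/
def tor (M : ModuleCat.{u} Aᵐᵒᵖ) (N : ModuleCat.{u} A) (i : ℕ) : AddCommGrpCat.{u} :=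
  ((tensorFunctor M).leftDerived i).obj N

end Tor

variable (K A : Type u) [Field K] [Ring A] [Algebra K A]

/-- A functor `mod(B) ⥤ mod(A)`, where `B` is some finite-dimensional `K`-algebra. (Over a
finite-dimensional algebra, finitely generated modules and finite-dimensional modules agree.) -/
structure ModFunctor where
  B : Type u
  [ring : Ring B]
  [algebra : Algebra K B]
  [finite : Module.Finite K B]
  functor : FGModuleCat.{u} B ⥤ FGModuleCat.{u} A

attribute [instance] ModFunctor.ring ModFunctor.algebra ModFunctor.finite

/-- A finite-dimensional `K`-algebra `B` with a homomorphism of `K`-algebras `A → B`. -/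
structure AlgebraUnder where
  B : Type u
  [ring : Ring B]
  [algebra : Algebra K B]
  [finite : Module.Finite K B]
  hom : A →ₐ[K] B

attribute [instance] AlgebraUnder.ring AlgebraUnder.algebra AlgebraUnder.finite

namespace ModFunctor

variable {K A}

/-- `F : mod(B) ⥤ mod(A)` and `F' : mod(B') ⥤ mod(A)` are equivalent if there is an equivalence of
categories `G : mod(B) ≌ mod(B')` such that `F' ∘ G` and `F` are naturally isomorphic. -/
def Equivalent (E E' : ModFunctor K A) : Prop :=
  ∃ G : FGModuleCat.{u} E.B ≌ FGModuleCat.{u} E'.B,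
    Nonempty (G.functor ⋙ E'.functor ≅ E.functor)

instance setoid : Setoid (ModFunctor K A) where
  r := Equivalent
  iseqv :=
    { refl := fun _ => ⟨CategoryTheory.Equivalence.refl, ⟨Functor.leftUnitor _⟩⟩
      symm := fun ⟨G, ⟨e⟩⟩ =>
        ⟨G.symm, ⟨Functor.isoWhiskerLeft G.inverse e.symm ≪≫
          (Functor.associator _ _ _).symm ≪≫
          Functor.isoWhiskerRight G.counitIso _ ≪≫ Functor.leftUnitor _⟩⟩
      trans := fun ⟨G, ⟨e⟩⟩ ⟨G', ⟨e'⟩⟩ =>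
        ⟨G.trans G', ⟨Functor.associator _ _ _ ≪≫
          Functor.isoWhiskerLeft G.functor e' ≪≫ e⟩⟩ }

variable [Module.Finite K A]

/-- The functor `mod(B) ⥤ mod(A)` is a weakly homological embedding. -/
def IsWeaklyHomological (E : ModFunctor K A) : Prop :=
  haveI := IsNoetherianRing.of_finite K A
  haveI := IsNoetherianRing.of_finite K E.B
  IsWeaklyHomologicalEmbedding E.functor

/-- The functor `mod(B) ⥤ mod(A)` is a homological embedding. -/
def IsHomological (E : ModFunctor K A) : Prop :=
  haveI := IsNoetherianRing.of_finite K A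
  haveI := IsNoetherianRing.of_finite K E.B
  IsHomologicalEmbedding E.functor

end ModFunctor

namespace AlgebraUnder

variable {K A}

/-- `f : A → B` and `f' : A → B'` are equivalent if there is an isomorphism of algebras
`g : B' → B` with `g ∘ f' = f`. -/
def Equivalent (R R' : AlgebraUnder K A) : Prop :=
  ∃ g : R'.B ≃ₐ[K] R.B, (g : R'.B →ₐ[K] R.B).comp R'.hom = R.hom

instance setoid : Setoid (AlgebraUnder K A) where
  r := Equivalent
  iseqv :=
    { refl := fun R => ⟨AlgEquiv.refl, rfl⟩
      symm := fun {R R'} ⟨g, hg⟩ => ⟨g.symm, by rw [← hg]; ext a; simp⟩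
      trans := fun {R R' R''} ⟨g, hg⟩ ⟨g', hg'⟩ =>
        ⟨g'.trans g, by rw [← hg, ← hg']; ext a; simp⟩ }

/-- `A → B` is an epimorphism in the category of rings. -/
def IsRingEpi (R : AlgebraUnder K A) : Prop :=
  Epi (RingCat.ofHom (R.hom : A →+* R.B))

/-- `B` as a left `A`-module. -/
def leftModule (R : AlgebraUnder K A) : ModuleCat.{u} A :=
  (ModuleCat.restrictScalars (R.hom : A →+* R.B)).obj (ModuleCat.of R.B R.B)

/-- `B` as a right `A`-module. -/
def rightModule (R : AlgebraUnder K A) : ModuleCat.{u} Aᵐᵒᵖ :=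
  (ModuleCat.restrictScalars (RingHom.op (R.hom : A →+* R.B))).obj
    (ModuleCat.of (R.B)ᵐᵒᵖ R.B)

/-- `Tor_i^A(B, B) = 0`. -/
def TorVanishes (R : AlgebraUnder K A) (i : ℕ) : Prop :=
  IsZero (tor R.rightModule R.leftModule i)

/-- The restriction of a finitely generated `B`-module to `A` is finitely generated. -/
lemma finite_restrictScalars (R : AlgebraUnder K A) (M : FGModuleCat.{u} R.B) :
    ModuleCat.isFG A ((ModuleCat.restrictScalars (R.hom : A →+* R.B)).obj M.obj) := by
  let _ : Module A R.B := Module.compHom R.B (R.hom : A →+* R.B)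
  let _ : Module A M.obj := Module.compHom M.obj (R.hom : A →+* R.B)
  have : IsScalarTower K A R.B := ⟨fun k a b => by
    change R.hom (k • a) * b = k • (R.hom a * b)
    rw [map_smul, smul_mul_assoc]⟩
  have : IsScalarTower A R.B M.obj := ⟨fun a b m => mul_smul (R.hom a) b m⟩
  have : Module.Finite A R.B := Module.Finite.of_restrictScalars_finite K A R.B
  have : Module.Finite R.B M.obj := M.property
  exact Module.Finite.trans (R := A) R.B M.obj

/-- The restriction functor `mod(B) ⥤ mod(A)` along `A → B`. -/
def restriction (R : AlgebraUnder K A) : ModFunctor K A where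
  B := R.B
  functor := (ModuleCat.isFG A).lift
    ((ModuleCat.isFG R.B).ι ⋙ ModuleCat.restrictScalars (R.hom : A →+* R.B))
    R.finite_restrictScalars

instance (S : Type u) [Ring S] : (ModuleCat.isFG.{u} S).IsClosedUnderIsomorphisms where
  of_iso e (_ : Module.Finite _ _) := Module.Finite.equiv e.toLinearEquiv

lemma isFG_restrictScalars_iff {R S : Type u} [Ring R] [Ring S] (e : R ≃+* S)
    (M : ModuleCat.{u} S) :
    ModuleCat.isFG R ((ModuleCat.restrictScalars e.toRingHom).obj M) ↔ ModuleCat.isFG S M := by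
  have : RingHomSurjective e.toRingHom := ⟨e.surjective⟩
  have : RingHomSurjective e.symm.toRingHom := ⟨e.symm.surjective⟩
  let φ : (ModuleCat.restrictScalars e.toRingHom).obj M →ₛₗ[e.toRingHom] M :=
    { toFun := fun m => m
      map_add' := fun _ _ => rfl
      map_smul' := fun _ _ => rfl }
  let ψ : M →ₛₗ[e.symm.toRingHom] (ModuleCat.restrictScalars e.toRingHom).obj M :=
    { toFun := fun m => m
      map_add' := fun _ _ => rfl
      map_smul' := fun s m => by
        change s • m = e (e.symm s) • m
        rw [e.apply_symm_apply] }
  constructor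
  · intro (h : Module.Finite _ _)
    exact Module.Finite.of_surjective φ fun m => ⟨m, rfl⟩
  · intro (h : Module.Finite _ _)
    exact Module.Finite.of_surjective ψ fun m => ⟨m, rfl⟩

/-- The restriction functors of equivalent homomorphisms are equivalent. -/
lemma restriction_equivalent {R R' : AlgebraUnder K A} (h : R.Equivalent R') :
    R.restriction.Equivalent R'.restriction := by
  obtain ⟨g, hg⟩ := h
  have hg' : (R.hom : A →+* R.B) =
      (g : R'.B ≃+* R.B).toRingHom.comp (R'.hom : A →+* R'.B) :=
    RingHom.ext fun a => (DFunLike.congr_fun hg a).symm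
  refine ⟨(ModuleCat.restrictScalarsEquivalenceOfRingEquiv (g : R'.B ≃+* R.B)).congrFullSubcategory
    (P := ModuleCat.isFG R.B) (Q := ModuleCat.isFG R'.B) ?_, ⟨?_⟩⟩
  · ext M
    exact isFG_restrictScalars_iff (g : R'.B ≃+* R.B) M
  · exact NatIso.ofComponents (fun M => (ModuleCat.isFG A).isoMk
      (ModuleCat.restrictScalarsComp'App (R'.hom : A →+* R'.B) (g : R'.B ≃+* R.B).toRingHom
        (R.hom : A →+* R.B) hg' M.obj).symm) (fun f => rfl)

end AlgebraUnder

/-- The assignment `[F] ↦ Im(F)` sending the equivalence class of a functor `mod(B) ⥤ mod(A)` to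
its essential image. -/
def imageMap : Quotient (ModFunctor.setoid (K := K) (A := A)) →
    ObjectProperty (FGModuleCat.{u} A) :=
  Quotient.lift (fun E => E.functor.essImage) (by
    rintro E E' ⟨G, ⟨e⟩⟩
    rw [← Functor.essImage_eq_of_natIso e]
    ext Y
    constructor
    · rintro ⟨X, ⟨i⟩⟩
      exact ⟨G.functor.obj X, ⟨i⟩⟩
    · rintro ⟨X, ⟨i⟩⟩
      exact ⟨G.inverse.obj X, ⟨E'.functor.mapIso (G.counitIso.app X) ≪≫ i⟩⟩)

/-- The assignment sending the class of `A → B` to the class of its restriction functor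
`mod(B) ⥤ mod(A)`. -/
def restrictionMap : Quotient (AlgebraUnder.setoid (K := K) (A := A)) →
    Quotient (ModFunctor.setoid (K := K) (A := A)) :=
  Quotient.map AlgebraUnder.restriction fun _ _ h => AlgebraUnder.restriction_equivalent h

variable [Module.Finite K A]

/-- Equivalence classes of weakly homological embeddings `mod(B) ⥤ mod(A)`. -/
def weaklyHomologicalClasses : Set (Quotient (ModFunctor.setoid (K := K) (A := A))) :=
  {c | ∃ E : ModFunctor K A, E.IsWeaklyHomological ∧ ⟦E⟧ = c}

/-- Equivalence classes of homological embeddings `mod(B) ⥤ mod(A)`. -/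
def homologicalClasses : Set (Quotient (ModFunctor.setoid (K := K) (A := A))) :=
  {c | ∃ E : ModFunctor K A, E.IsHomological ∧ ⟦E⟧ = c}

/-- Functorially finite wide subcategories of `mod(A)`. -/
def functoriallyFiniteWide (A : Type u) [Ring A] : Set (ObjectProperty (FGModuleCat.{u} A)) :=
  {W | IsFunctoriallyFinite W ∧ IsWide W}

/-- Equivalence classes of ring epimorphisms `A → B` with `Tor_1^A(B, B) = 0`. -/
def torOneRingEpiClasses (K A : Type u) [Field K] [Ring A] [Algebra K A] :
    Set (Quotient (AlgebraUnder.setoid (K := K) (A := A))) :=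
  {c | ∃ R : AlgebraUnder K A, (R.IsRingEpi ∧ R.TorVanishes 1) ∧ ⟦R⟧ = c}

/-- Equivalence classes of ring epimorphisms `A → B` with `Tor_i^A(B, B) = 0` for all `i > 0`. -/
def homologicalRingEpiClasses (K A : Type u) [Field K] [Ring A] [Algebra K A] :
    Set (Quotient (AlgebraUnder.setoid (K := K) (A := A))) :=
  {c | ∃ R : AlgebraUnder K A, (R.IsRingEpi ∧ ∀ i : ℕ, 0 < i → R.TorVanishes i) ∧ ⟦R⟧ = c}

end ModEmb

end

/-! Everything is tested on projectives and injectives. For a fully faithful exact `F : mod(B) ⥤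
mod(A)`, the maps on `Ext^i` are bijective for `i ≤ n` once `Ext^i_A(F P, F I) = 0` for all `0 < i ≤
n`, `P` projective and `I` injective (`mapExt_bijective_of_forall_injective`); the converse is
clear, since `Ext^i_B(P, I) = 0`. For restriction along `A → B`, `P` and `I` are retracts of finite
sums of `B` and of `D(B) = Hom_K(B, K)`, and the duality `Hom_A(X, D(B)) ≅ D(B ⊗_A X)` turns the
vanishing into `Tor_i^A(B, B) = 0` (`torVanishes_iff_extVanishes`). Restriction is always faithful
and exact, and it is full exactly for ring epimorphisms.

The essential image of a fully faithful exact functor is closed under kernels and cokernels, and it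
has approximations built from presentations by sums of `B` and copresentations by sums of `D(B)`.
Closure under extensions is the degree one vanishing (`essImage_isClosedUnderExtensions`,
`extVanishes_one`).

Conversely, let `W` be functorially finite and wide. A left approximation `A → X` of minimal
dimension is a universal map to `W` (`exists_isFreeOn`). With `B = End_A(X)ᵒᵖ`, the module `X`
becomes the regular `B`-module. Objects of `W` carry a `B`-action, and `B`-modules, being cokernels
of maps between sums of copies of `X`, lie in `W`. So `W` is the image of restriction along a ring
epimorphism (`exists_isRingEpi_essImage_eq`).

Injectivity holds because the essential image determines a fully faithful functor up to equivalence,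
and a ring epimorphism up to isomorphism. -/

noncomputable section

namespace ModEmb

/-! ### Comparing `Ext` groups by dimension shifting -/

section ExtComparison

open Abelian

universe w w'

variable {C D : Type*} [Category* C] [Category* D] [Abelian C] [Abelian D]

/-- `Ext^i(F P, F I)` vanishes for all projective `P` and injective `I`. -/
def ExtVanishes (F : C ⥤ D) (i : ℕ) : Prop :=
  letI := HasExt.standard D
  ∀ P I : C, Projective P → Injective I → ∀ e : Ext (F.obj P) (F.obj I) i, e = 0

lemma mk₀_comp_g_comp_extClass [HasExt.{w} C] {S : ShortComplex C} (hS : S.ShortExact) {X : C}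
    (f : X ⟶ S.X₂) : (Ext.mk₀ (f ≫ S.g)).comp hS.extClass (zero_add 1) = 0 := by
  rw [← Ext.mk₀_comp_mk₀, Ext.comp_assoc_of_second_deg_zero, hS.comp_extClass, Ext.comp_zero]

lemma ext_eq_zero_of_iso [HasExt.{w} C] {X X' Y Y' : C} (a : X ≅ X') (b : Y ≅ Y') {i : ℕ}
    (h : ∀ e : Ext.{w} X' Y' i, e = 0) (e : Ext.{w} X Y i) : e = 0 := by
  have h₁ := h (((Ext.mk₀ a.inv).comp e (zero_add i)).comp (Ext.mk₀ b.hom) (add_zero i))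
  have h₂ : e = ((Ext.mk₀ a.hom).comp (((Ext.mk₀ a.inv).comp e (zero_add i)).comp
      (Ext.mk₀ b.hom) (add_zero i)) (zero_add i)).comp (Ext.mk₀ b.inv) (add_zero i) := by
    simp
  rw [h₂, h₁, Ext.comp_zero, Ext.zero_comp]

variable (F : C ⥤ D) [F.Additive] [PreservesFiniteLimits F] [PreservesFiniteColimits F]
  [F.Full] [F.Faithful]

omit [F.Faithful] in
-- Dimension shifting in the second variable. Embed `Y` in an injective `J` with cokernel `Z`: since
-- `Ext^{i+1}(F P, F J) = 0`, the class `e` comes from `Ext^i(F P, F Z)`. For `i = 0` this is a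
-- morphism `F P ⟶ F Z`, which by fullness comes from `P ⟶ Z`, hence lifts to `J` and has zero
-- connecting image.
lemma ext_eq_zero_of_forall_injective [EnoughInjectives C] [HasExt.{w'} D] {P : C} [Projective P]
    (n : ℕ) (h : ∀ i, i < n → ∀ I : C, Injective I →
      ∀ e : Ext.{w'} (F.obj P) (F.obj I) (i + 1), e = 0)
    (i : ℕ) (hi : i < n) (Y : C) (e : Ext.{w'} (F.obj P) (F.obj Y) (i + 1)) : e = 0 := by
  induction i generalizing Y with
  | zero =>
    let J : InjectivePresentation Y := Classical.arbitrary _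
    let S := ShortComplex.mk _ _ (cokernel.condition J.f)
    have hS : S.ShortExact := { exact := ShortComplex.exact_cokernel J.f }
    obtain ⟨x, rfl⟩ := Ext.covariant_sequence_exact₁ _ (hS.map_of_exact F) e
      (h 0 hi _ J.injective _) (zero_add 1)
    obtain ⟨y, rfl⟩ := (Ext.mk₀_bijective _ _).2 x
    obtain ⟨y, rfl⟩ := F.map_surjective y
    have : Epi S.g := hS.epi_g
    rw [← Projective.factorThru_comp y S.g, F.map_comp]
    exact mk₀_comp_g_comp_extClass (hS.map_of_exact F) _
  | succ i ih =>
    let J : InjectivePresentation Y := Classical.arbitrary _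
    let S := ShortComplex.mk _ _ (cokernel.condition J.f)
    have hS : S.ShortExact := { exact := ShortComplex.exact_cokernel J.f }
    obtain ⟨x, rfl⟩ := Ext.covariant_sequence_exact₁ _ (hS.map_of_exact F) e
      (h _ hi _ J.injective _) rfl
    exact congr($(ih (by omega) _ x).comp _ rfl).trans (by apply Ext.zero_comp)

/-- Dimension shifting in the first variable. For `0 → L → P → X → 0` with `P` projective,
`Ext^{i+1}` out of `P` and out of `F P` into `Y` and `F Y` vanishes, so on both sides `Ext^{i+1}`
out of `X` is the cokernel of a map between groups of degree `i`, where the comparison is already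
bijective. -/
lemma mapExt_bijective_of_forall_injective [EnoughProjectives C] [EnoughInjectives C]
    [HasExt.{w} C] [HasExt.{w'} D]
    (n : ℕ) (h : ∀ i, i < n → ∀ P I : C, Projective P → Injective I →
      ∀ e : Ext.{w'} (F.obj P) (F.obj I) (i + 1), e = 0) (i : ℕ) (hi : i ≤ n) (X Y : C) :
    Function.Bijective (F.mapExtAddHom X Y i) := by
  induction i generalizing X with
  | zero => simpa [Ext.mapExactFunctor₀] using
      ⟨Functor.Faithful.map_injective, Functor.Full.map_surjective⟩
  | succ i ih =>
    let P : ProjectivePresentation X := Classical.arbitrary _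
    let S := ShortComplex.mk _ _ (kernel.condition P.f)
    have hP : Projective S.X₂ := P.projective
    have hS : S.ShortExact := { exact := ShortComplex.exact_kernel P.f }
    have : Subsingleton (Ext.{w} S.X₂ Y (i + 1)) := Ext.subsingleton_of_projective _ _ _
    have : Subsingleton (Ext.{w'} (F.obj S.X₂) (F.obj Y) (i + 1)) :=
      subsingleton_of_forall_eq 0 (ext_eq_zero_of_forall_injective F n
        (fun j hj I hI e => h j hj _ _ hP hI e) i hi Y)
    exact AddMonoidHom.bijective_of_surjective_of_bijective_of_right_exact _ _ _ _
      (F.mapExtAddHom S.X₂ Y i) (F.mapExtAddHom S.X₁ Y i) (F.mapExtAddHom S.X₃ Y (i + 1))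
      (by
        ext x
        exact (congr(Ext.comp $((Ext.mapExactFunctor_mk₀ F S.f).symm) _ _)).trans
          (Ext.mapExactFunctor_comp F (Ext.mk₀ S.f) x (zero_add i)).symm)
      (by
        ext x
        exact (congr(Ext.comp $((Ext.mapExactFunctor_extClass F hS).symm) _ _)).trans
          (Ext.mapExactFunctor_comp F hS.extClass x (add_comm 1 i)).symm)
      ((ShortComplex.ab_exact_iff_function_exact _).1
        (Ext.contravariant_sequence_exact₁' hS Y i (i + 1) (add_comm 1 i)))
      ((ShortComplex.ab_exact_iff_function_exact _).1
        (Ext.contravariant_sequence_exact₁' (hS.map_of_exact F) (F.obj Y) i (i + 1) (add_comm 1 i)))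
      (ih (by omega) _).surjective (ih (by omega) _)
      (fun x₃ ↦ Ext.contravariant_sequence_exact₃ hS _ x₃ (by subsingleton) (add_comm 1 i))
      (fun y₃ ↦ Ext.contravariant_sequence_exact₃ (hS.map_of_exact F) _ y₃
        (this.elim _ _) (add_comm 1 i))

omit [F.Additive] [PreservesFiniteLimits F] [PreservesFiniteColimits F] [F.Full] [F.Faithful] in
variable {F} in
lemma IsFullyFaithfulExact.extIso_of_extVanishes [EnoughProjectives C] [EnoughInjectives C]
    (hF : IsFullyFaithfulExact F) {n : ℕ} (h : ∀ i, 0 < i → i ≤ n → ExtVanishes F i) :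
    ∀ i, i ≤ n → hF.ExtIso i := by
  have := hF.additive
  have := hF.preservesFiniteLimits
  have := hF.preservesFiniteColimits
  have := hF.full
  have := hF.faithful
  let _ := HasExt.standard C
  let _ := HasExt.standard D
  intro i hi X Y
  exact mapExt_bijective_of_forall_injective F n
    (fun j hj P I hP hI e => h (j + 1) (by omega) (by omega) P I hP hI e) i hi X Y

omit [F.Additive] [PreservesFiniteLimits F] [PreservesFiniteColimits F] [F.Full] [F.Faithful] in
variable {F} in
lemma IsFullyFaithfulExact.extVanishes_of_extIso (hF : IsFullyFaithfulExact F) {i : ℕ} (hi : 0 < i)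
    (h : hF.ExtIso i) : ExtVanishes F i := by
  have := hF.additive
  have := hF.preservesFiniteLimits
  have := hF.preservesFiniteColimits
  let _ := HasExt.standard C
  let _ := HasExt.standard D
  intro P I hP hI e
  obtain ⟨e, rfl⟩ := (h P I).2 e
  obtain ⟨j, rfl⟩ := Nat.exists_eq_succ_of_ne_zero hi.ne'
  rw [Ext.eq_zero_of_projective e, map_zero]

/-- The weakly homological embeddings are detected on projectives and injectives. -/
lemma isWeaklyHomologicalEmbedding_iff [EnoughProjectives C] [EnoughInjectives C] {F : C ⥤ D} :
    IsWeaklyHomologicalEmbedding F ↔ IsFullyFaithfulExact F ∧ ExtVanishes F 1 :=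
  ⟨fun ⟨h, h'⟩ => ⟨h, h.extVanishes_of_extIso one_pos h'⟩, fun ⟨h, h'⟩ =>
    ⟨h, h.extIso_of_extVanishes (n := 1) (fun i hi hi' => by
      obtain rfl : i = 1 := by omega
      exact h') 1 le_rfl⟩⟩

/-- The homological embeddings are detected on projectives and injectives. -/
lemma isHomologicalEmbedding_iff [EnoughProjectives C] [EnoughInjectives C] {F : C ⥤ D} :
    IsHomologicalEmbedding F ↔ IsFullyFaithfulExact F ∧ ∀ i, 0 < i → ExtVanishes F i :=
  ⟨fun ⟨h, h'⟩ => ⟨h, fun i hi => h.extVanishes_of_extIso hi (h' i hi)⟩, fun ⟨h, h'⟩ =>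
    ⟨h, fun i _ => h.extIso_of_extVanishes (n := i) (fun i hi _ => h' i hi) i le_rfl⟩⟩

section Transport

variable {C' : Type*} [Category* C'] [Abelian C']

omit [Abelian C] [Abelian C'] in
-- Vanishing depends only on the objects `F P` and `F I` and not on the maps induced by `F`, so it
-- is transported more easily than the bijectivity on `Ext`.
lemma ExtVanishes.of_equivalence {F : C ⥤ D} {F' : C' ⥤ D} (G : C ≌ C')
    (e : G.functor ⋙ F' ≅ F) {i : ℕ} (h : ExtVanishes F' i) : ExtVanishes F i := by
  let _ := HasExt.standard D
  intro P I hP hI x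
  have h₁ : Projective (G.functor.obj P) := (G.map_projective_iff P).2 hP
  have h₂ : Injective (G.functor.obj I) := (G.map_injective_iff I).2 hI
  exact ext_eq_zero_of_iso (e.app P).symm (e.app I).symm (h _ _ h₁ h₂) x

omit [Abelian C] [Abelian D] [Abelian C'] in
lemma IsFullyFaithfulExact.of_equivalence {F : C ⥤ D} {F' : C' ⥤ D} (G : C ≌ C')
    (e : G.functor ⋙ F' ≅ F) (h : IsFullyFaithfulExact F') : IsFullyFaithfulExact F := by
  have := h.preservesFiniteLimits
  have := h.preservesFiniteColimits
  have := h.full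
  have := h.faithful
  exact ⟨.of_iso e, .of_iso e, ⟨fun J _ _ =>
    preservesLimitsOfShape_of_natIso e⟩, ⟨fun J _ _ => preservesColimitsOfShape_of_natIso e⟩⟩

end Transport

end ExtComparison


/-! ### Finitely generated modules: epimorphisms, monomorphisms, projectives -/

section FGModules

variable {B : Type u} [Ring B]

/-- A linear map between finitely generated modules, as a morphism of `FGModuleCat B`. -/
abbrev fgHom {X Y : FGModuleCat.{u} B} (f : X →ₗ[B] Y) : X ⟶ Y :=
  ObjectProperty.homMk (ModuleCat.ofHom f)

lemma fgHom_ext {X Y : FGModuleCat.{u} B} {f g : X ⟶ Y} (h : ∀ x : X, f.hom.hom x = g.hom.hom x) :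
    f = g :=
  FGModuleCat.hom_ext (LinearMap.ext h)

lemma fg_sum_apply {X Y : FGModuleCat.{u} B} {ι : Type*} (s : Finset ι) (f : ι → (X ⟶ Y)) (x : X) :
    (∑ i ∈ s, f i).hom.hom x = ∑ i ∈ s, (f i).hom.hom x := by
  classical
  induction s using Finset.induction_on with
  | empty => simp
  | insert a s ha ih => rw [Finset.sum_insert ha, Finset.sum_insert ha, ← ih]; rfl

lemma fg_surjective_of_epi {X Y : FGModuleCat.{u} B} (f : X ⟶ Y) [Epi f] :
    Function.Surjective f.hom.hom := by
  rw [← LinearMap.range_eq_top]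
  let Q : FGModuleCat.{u} B := FGModuleCat.of B (Y ⧸ LinearMap.range f.hom.hom)
  have h : f ≫ (fgHom (LinearMap.range f.hom.hom).mkQ : Y ⟶ Q) = f ≫ (fgHom 0 : Y ⟶ Q) := by
    refine fgHom_ext fun x => ?_
    exact (Submodule.Quotient.mk_eq_zero _).2 ⟨x, rfl⟩
  rw [cancel_epi] at h
  rw [eq_top_iff]
  intro y _
  exact (Submodule.Quotient.mk_eq_zero _).1 congr(($h).hom.hom y)

lemma fg_epi_of_surjective {X Y : FGModuleCat.{u} B} (f : X ⟶ Y)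
    (h : Function.Surjective f.hom.hom) : Epi f where
  left_cancellation _ _ hg := by
    refine fgHom_ext fun y => ?_
    obtain ⟨x, rfl⟩ := h y
    exact congr(($hg).hom.hom x)

/-- Over a Noetherian ring the kernel is finitely generated, hence available as a test object. -/
lemma fg_injective_of_mono [IsNoetherianRing B] {X Y : FGModuleCat.{u} B} (f : X ⟶ Y) [Mono f] :
    Function.Injective f.hom.hom := by
  rw [← LinearMap.ker_eq_bot]
  let Q : FGModuleCat.{u} B := FGModuleCat.of B (LinearMap.ker f.hom.hom)
  have h : (fgHom (LinearMap.ker f.hom.hom).subtype : Q ⟶ X) ≫ f = (fgHom 0 : Q ⟶ X) ≫ f := by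
    refine fgHom_ext fun x => ?_
    exact x.2.trans (map_zero f.hom.hom).symm
  rw [cancel_mono] at h
  rw [eq_bot_iff]
  intro y hy
  exact congr(($h).hom.hom ⟨y, hy⟩)

lemma fg_mono_of_injective {X Y : FGModuleCat.{u} B} (f : X ⟶ Y)
    (h : Function.Injective f.hom.hom) : Mono f where
  right_cancellation _ _ hg := fgHom_ext fun y => h congr(($hg).hom.hom y)

lemma fg_projective (P : FGModuleCat.{u} B) [Module.Projective B P] : Projective P where
  factors f e _ := by
    obtain ⟨g, hg⟩ := Module.projective_lifting_property e.hom.hom f.hom.hom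
      (fg_surjective_of_epi e)
    exact ⟨fgHom g, FGModuleCat.hom_ext hg⟩

variable (B) in
/-- The regular module, as a finitely generated module. -/
abbrev regular : FGModuleCat.{u} B := FGModuleCat.of B B

/-- The free module of rank `n`. -/
abbrev fgFree (B : Type u) [Ring B] (n : ℕ) : FGModuleCat.{u} B :=
  FGModuleCat.of B (Fin n → B)

instance (n : ℕ) : Projective (fgFree B n) := by
  have : Module.Projective B (fgFree B n) := inferInstanceAs (Module.Projective B (Fin n → B))
  exact fg_projective _

instance : Projective (regular B) := by
  have : Module.Projective B (regular B) := inferInstanceAs (Module.Projective B B)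
  exact fg_projective _

lemma exists_epi_fgFree (M : FGModuleCat.{u} B) : ∃ (n : ℕ) (f : fgFree B n ⟶ M), Epi f := by
  obtain ⟨n, f, hf⟩ := Module.Finite.exists_fin' B M
  exact ⟨n, fgHom f, fg_epi_of_surjective _ hf⟩

instance : EnoughProjectives (FGModuleCat.{u} B) where
  presentation M := by
    obtain ⟨n, f, hf⟩ := exists_epi_fgFree M
    exact ⟨{ p := fgFree B n, f := f }⟩

/-- The dual basis lemma. -/
lemma exists_dual_basis (P : FGModuleCat.{u} B) [Projective P] :
    ∃ (n : ℕ) (α : Fin n → (P ⟶ regular B)) (β : Fin n → (regular B ⟶ P)),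
      𝟙 P = ∑ i, α i ≫ β i := by
  obtain ⟨n, f, hf⟩ := exists_epi_fgFree P
  let s := Projective.factorThru (𝟙 P) f
  have hs : s ≫ f = 𝟙 P := Projective.factorThru_comp _ _
  let p (i : Fin n) : fgFree B n ⟶ regular B :=
    fgHom (LinearMap.proj (R := B) (φ := fun _ : Fin n => B) i)
  let ι (i : Fin n) : regular B ⟶ fgFree B n := fgHom (LinearMap.single B (fun _ => B) i)
  have h : ∑ i, p i ≫ ι i = 𝟙 (fgFree B n) := by
    refine fgHom_ext fun x => ?_
    rw [fg_sum_apply]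
    exact Finset.univ_sum_single (M := fun _ : Fin n => B) x
  refine ⟨n, fun i => s ≫ p i, fun i => ι i ≫ f, ?_⟩
  have : ∑ i, (s ≫ p i) ≫ ι i ≫ f = s ≫ (∑ i, p i ≫ ι i) ≫ f := by
    simp [Preadditive.sum_comp, Preadditive.comp_sum]
  rw [this, h, Category.id_comp, hs]

/-- A categorical projective is a retract of a finite free module. This lets resolutions in
`FGModuleCat` compute `Tor`, which is defined over all modules. -/
lemma module_projective_of_projective (P : FGModuleCat.{u} B) [Projective P] :
    Module.Projective B P := by
  obtain ⟨n, f, hf⟩ := exists_epi_fgFree P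
  refine Module.Projective.of_split (M := Fin n → B) (Projective.factorThru (𝟙 P) f).hom.hom
    f.hom.hom ?_
  exact congr(($(Projective.factorThru_comp (𝟙 P) f)).hom.hom)

end FGModules

/-! ### Coinduced modules -/

section Coinduced

variable (K B : Type u) [Field K] [Ring B] [Algebra K B]

/-- The coinduced left `B`-module `Hom_K(B, V)`, with `(b • φ) x = φ (x * b)`. -/
def Coinduced (V : Type u) [AddCommGroup V] [Module K V] : Type u := B →ₗ[K] V

namespace Coinduced

variable {K B} {V : Type u} [AddCommGroup V] [Module K V]

instance : AddCommGroup (Coinduced K B V) := inferInstanceAs (AddCommGroup (B →ₗ[K] V))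

instance : Module K (Coinduced K B V) := inferInstanceAs (Module K (B →ₗ[K] V))

instance : FunLike (Coinduced K B V) B V := inferInstanceAs (FunLike (B →ₗ[K] V) B V)

instance : LinearMapClass (Coinduced K B V) K B V :=
  inferInstanceAs (LinearMapClass (B →ₗ[K] V) K B V)

@[ext]
lemma ext {φ ψ : Coinduced K B V} (h : ∀ b, φ b = ψ b) : φ = ψ := DFunLike.ext _ _ h

instance : Module B (Coinduced K B V) where
  smul b φ := LinearMap.comp (M₂ := B) φ (LinearMap.mulRight K b)
  one_smul φ := ext fun b => congrArg φ (mul_one b)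
  mul_smul b c φ := ext fun x => congrArg φ (mul_assoc x b c).symm
  smul_zero _ := rfl
  smul_add _ _ _ := rfl
  add_smul b c φ := ext fun x => (congrArg φ (mul_add x b c)).trans (map_add φ _ _)
  zero_smul φ := ext fun x => (congrArg φ (mul_zero x)).trans (map_zero φ)

@[simp] lemma smul_apply (b : B) (φ : Coinduced K B V) (x : B) : (b • φ) x = φ (x * b) := rfl

@[simp] lemma add_apply (φ ψ : Coinduced K B V) (x : B) : (φ + ψ) x = φ x + ψ x := rfl

@[simp] lemma smul_apply' (k : K) (φ : Coinduced K B V) (x : B) : (k • φ) x = k • φ x := rfl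

instance : IsScalarTower K B (Coinduced K B V) where
  smul_assoc k b φ := ext fun x => by simp

instance [Module.Finite K B] [Module.Finite K V] : Module.Finite K (Coinduced K B V) :=
  inferInstanceAs (Module.Finite K (B →ₗ[K] V))

instance [Module.Finite K B] [Module.Finite K V] : Module.Finite B (Coinduced K B V) :=
  Module.Finite.of_restrictScalars_finite K B _

/-- The adjunction `Hom_K(M, V) → Hom_B(M, Hom_K(B, V))`. -/
def lift {M : Type*} [AddCommGroup M] [Module K M] [Module B M] [IsScalarTower K B M]
    (f : M →ₗ[K] V) : M →ₗ[B] Coinduced K B V where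
  toFun m := (f.comp ((LinearMap.toSpanSingleton B M m).restrictScalars K) : B →ₗ[K] V)
  map_add' m m' := ext fun b => by
    change f (b • (m + m')) = f (b • m) + f (b • m')
    simp
  map_smul' b m := ext fun c => by
    change f (c • b • m) = f ((c * b) • m)
    rw [mul_smul]

@[simp] lemma lift_apply {M : Type*} [AddCommGroup M] [Module K M] [Module B M]
    [IsScalarTower K B M] (f : M →ₗ[K] V) (m : M) (b : B) : lift f m b = f (b • m) := rfl

/-- Evaluation at `1`. -/
def eval {M : Type*} [AddCommGroup M] [Module K M] [Module B M] [IsScalarTower K B M]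
    (g : M →ₗ[B] Coinduced K B V) : M →ₗ[K] V where
  toFun m := g m 1
  map_add' m m' := by simp
  map_smul' k m := by rw [(g.restrictScalars K).map_smul_of_tower k m |> fun h => (h :
    g (k • m) = k • g m)]; simp

end Coinduced

end Coinduced

/-! ### Injectives and finiteness of morphism spaces over a finite-dimensional algebra -/

section FiniteDimensional

variable (K : Type u) {B : Type u} [Field K] [Ring B] [Algebra K B] [Module.Finite K B]

/-- The `K`-module structure on a module over a `K`-algebra. -/
abbrev scalarModule (M : FGModuleCat.{u} B) : Module K M := Module.compHom M (algebraMap K B)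

omit [Module.Finite K B] in
lemma scalarModule_isScalarTower (M : FGModuleCat.{u} B) :
    letI := scalarModule K M; IsScalarTower K B M :=
  letI := scalarModule K M
  ⟨fun k b m => by
    change (k • b) • m = algebraMap K B k • b • m
    rw [Algebra.smul_def, mul_smul]⟩

lemma scalarModule_finite (M : FGModuleCat.{u} B) :
    letI := scalarModule K M; Module.Finite K M :=
  letI := scalarModule K M
  haveI := scalarModule_isScalarTower K M
  Module.Finite.trans B M

/-- The finitely generated module `Hom_K(B, V)`. -/
abbrev coinduced (B : Type u) [Ring B] [Algebra K B] [Module.Finite K B] (V : Type u)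
    [AddCommGroup V] [Module K V] [Module.Finite K V] : FGModuleCat.{u} B :=
  FGModuleCat.of B (Coinduced K B V)

/-- `Hom_B(-, Hom_K(B, V))` is `Hom_K(-, V)` by evaluation at `1`, and injections split over the
field `K`. -/
instance coinduced_injective [IsNoetherianRing B] (V : Type u)
    [AddCommGroup V] [Module K V] [Module.Finite K V] : Injective (coinduced K B V) where
  factors {X Y} g f _ := by
    let _ := scalarModule K X
    let _ := scalarModule K Y
    have := scalarModule_isScalarTower K X
    have := scalarModule_isScalarTower K Y
    obtain ⟨r, hr⟩ := (f.hom.hom.restrictScalars K).exists_leftInverse_of_injective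
      (LinearMap.ker_eq_bot.2 (fg_injective_of_mono f))
    have hr' (x : X) : r (f.hom.hom x) = x := congr($hr x)
    refine ⟨fgHom (Coinduced.lift ((Coinduced.eval g.hom.hom).comp r)), fgHom_ext fun x => ?_⟩
    refine Coinduced.ext fun b => ?_
    change g.hom.hom (r (b • f.hom.hom x)) 1 = g.hom.hom x b
    rw [← map_smul, hr', map_smul]
    simp

lemma exists_mono_coinduced (M : FGModuleCat.{u} B) :
    ∃ (V : Type u) (_ : AddCommGroup V) (_ : Module K V) (_ : Module.Finite K V)
      (f : M ⟶ coinduced K B V), Mono f := by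
  let _ := scalarModule K M
  have := scalarModule_isScalarTower K M
  have := scalarModule_finite K M
  refine ⟨M, inferInstance, inferInstance, this, fgHom (Coinduced.lift LinearMap.id),
    fg_mono_of_injective _ fun x y h => ?_⟩
  simpa using congr((show Coinduced K B M from $h) 1)

include K in
lemma fg_enoughInjectives [IsNoetherianRing B] : EnoughInjectives (FGModuleCat.{u} B) where
  presentation M := by
    obtain ⟨V, _, _, _, f, hf⟩ := exists_mono_coinduced K M
    exact ⟨{ J := coinduced K B V, injective := coinduced_injective K V, f := f }⟩

/-- The functoriality of coinduction. -/
def coinducedMap {V W : Type u} [AddCommGroup V] [Module K V] [Module.Finite K V]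
    [AddCommGroup W] [Module K W] [Module.Finite K W] (f : V →ₗ[K] W) :
    coinduced K B V ⟶ coinduced K B W :=
  fgHom { toFun := fun φ => LinearMap.comp (M₂ := V) f (show B →ₗ[K] V from φ)
          map_add' := fun φ ψ => Coinduced.ext fun b => map_add f (φ b) (ψ b)
          map_smul' := fun _ _ => rfl }

/-- The dual of the dual basis lemma. -/
lemma exists_codual_basis [IsNoetherianRing B] (I : FGModuleCat.{u} B) [Injective I] :
    ∃ (n : ℕ) (α : Fin n → (I ⟶ coinduced K B K)) (β : Fin n → (coinduced K B K ⟶ I)),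
      𝟙 I = ∑ i, α i ≫ β i := by
  obtain ⟨V, _, _, _, f, hf⟩ := exists_mono_coinduced K I
  let r := Injective.factorThru (𝟙 I) f
  have hr : f ≫ r = 𝟙 I := Injective.comp_factorThru _ _
  -- A basis of `V` splits `Hom_K(B, V)` into copies of `Hom_K(B, K)`.
  let b := Module.finBasis K V
  let a (i) : coinduced K B V ⟶ coinduced K B K := coinducedMap K (b.coord i)
  let c (i) : coinduced K B K ⟶ coinduced K B V :=
    coinducedMap K (LinearMap.toSpanSingleton K V (b i))
  refine ⟨_, fun i => f ≫ a i, fun i => c i ≫ r, ?_⟩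
  have : ∑ i, (f ≫ a i) ≫ c i ≫ r = f ≫ (∑ i, a i ≫ c i) ≫ r := by
    simp [Preadditive.sum_comp, Preadditive.comp_sum]
  rw [this]
  have h1 : ∑ i, a i ≫ c i = 𝟙 _ := by
    refine fgHom_ext fun x => ?_
    rw [fg_sum_apply]
    refine Coinduced.ext fun y => ?_
    let ev : Coinduced K B V →+ V :=
      { toFun := fun φ => φ y, map_zero' := rfl, map_add' := fun _ _ => rfl }
    change ev (∑ i, _) = ev x
    rw [map_sum]
    exact b.sum_repr (ev x)
  rw [h1, Category.id_comp, hr]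

/-- Multiplication by a scalar. -/
def scalarEnd (k : K) (M : FGModuleCat.{u} B) : M ⟶ M :=
  letI := scalarModule K M
  fgHom { toFun := fun m => algebraMap K B k • m
          map_add' := smul_add _
          map_smul' := fun b m => by
            simp only [← mul_smul, RingHom.id_apply, Algebra.commutes] }

/-- The morphisms between finitely generated modules over a finite-dimensional algebra form a
finite-dimensional space. -/
lemma exists_finite_generators (X Y : FGModuleCat.{u} B) :
    ∃ (n : ℕ) (f : Fin n → (X ⟶ Y)), ∀ g : X ⟶ Y, ∃ c : Fin n → K,
      g = ∑ i, scalarEnd K (c i) X ≫ f i ∧ g = ∑ i, f i ≫ scalarEnd K (c i) Y := by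
  let _ := scalarModule K X
  let _ := scalarModule K Y
  have := scalarModule_isScalarTower K X
  have := scalarModule_isScalarTower K Y
  have := scalarModule_finite K X
  have := scalarModule_finite K Y
  have : SMulCommClass B K Y := ⟨fun b k y => by
    change b • algebraMap K B k • y = algebraMap K B k • b • y
    simp only [← mul_smul, Algebra.commutes]⟩
  have : Module.Finite K (X →ₗ[B] Y) :=
    Module.Finite.of_injective (LinearMap.restrictScalarsₗ K B X Y K)
      (LinearMap.restrictScalars_injective K)
  let b := Module.finBasis K (X →ₗ[B] Y)
  -- Scalars are written as endomorphisms of the source or of the target, so that later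
  -- factorizations through `F` need only additivity of `F`, not `K`-linearity.
  refine ⟨_, fun i => fgHom (b i), fun g => ⟨fun i => b.repr g.hom.hom i, ?_, ?_⟩⟩
  · refine fgHom_ext fun x => ?_
    rw [fg_sum_apply]
    refine (congr($(b.sum_repr g.hom.hom) x)).symm.trans ?_
    rw [LinearMap.sum_apply]
    refine Finset.sum_congr rfl fun i _ => ?_
    exact (map_smul (b i) (algebraMap K B _) x).symm
  · refine fgHom_ext fun x => ?_
    rw [fg_sum_apply]
    refine (congr($(b.sum_repr g.hom.hom) x)).symm.trans ?_
    rw [LinearMap.sum_apply]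
    rfl

end FiniteDimensional


/-! ### Pushouts of short exact sequences -/

section Pushout

variable {C : Type*} [Category* C] [Abelian C]

/-- The pushout of a short exact sequence along a morphism from its first term. -/
abbrev pushoutComplex (S : ShortComplex C) {Z : C} (f : S.X₁ ⟶ Z) : ShortComplex C :=
  ShortComplex.mk (pushout.inr S.f f)
    (pushout.desc S.g (0 : Z ⟶ S.X₃) (by rw [S.zero, comp_zero])) (pushout.inr_desc _ _ _)

/-- The canonical morphism to the pushout of a short exact sequence. -/
abbrev toPushoutComplex (S : ShortComplex C) {Z : C} (f : S.X₁ ⟶ Z) : S ⟶ pushoutComplex S f where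
  τ₁ := f
  τ₂ := pushout.inl S.f f
  τ₃ := 𝟙 _
  comm₁₂ := pushout.condition.symm
  comm₂₃ := (pushout.inl_desc _ _ _).trans (Category.comp_id _).symm

lemma pushoutComplex_shortExact {S : ShortComplex C} (hS : S.ShortExact) {Z : C} (f : S.X₁ ⟶ Z) :
    (pushoutComplex S f).ShortExact := by
  have := hS.mono_f
  have := hS.epi_g
  have h₁ : Mono (pushoutComplex S f).f := inferInstanceAs (Mono (pushout.inr S.f f))
  have h₂ : Epi (pushoutComplex S f).g := by
    have : Epi (pushout.inl S.f f ≫ (pushoutComplex S f).g) := by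
      rw [pushout.inl_desc]
      infer_instance
    exact epi_of_epi (pushout.inl S.f f) _
  refine { exact := ShortComplex.exact_of_g_is_cokernel _ (CokernelCofork.IsColimit.ofπ' _ _ ?_) }
  intro W k hk
  have hk' : S.f ≫ pushout.inl S.f f ≫ k = 0 := by
    rw [pushout.condition_assoc, hk, comp_zero]
  refine ⟨hS.exact.desc _ hk', ?_⟩
  apply pushout.hom_ext
  · rw [pushout.inl_desc_assoc, hS.exact.g_desc]
  · rw [pushout.inr_desc_assoc, zero_comp, hk]

end Pushout

/-! ### Closure properties of the essential image -/

section EssImage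

open Abelian

variable {C D : Type*} [Category* C] [Category* D] [Abelian C] [Abelian D] {F : C ⥤ D}

/-- By fullness a morphism between objects of the image is, up to isomorphism, some `F.map g`, and
`F` preserves the kernel of `g`. -/
lemma IsFullyFaithfulExact.essImage_isClosedUnderKernels (hF : IsFullyFaithfulExact F) :
    F.essImage.IsClosedUnderKernels where
  kernels_le := by
    have := hF.preservesFiniteLimits
    have := hF.full
    rintro _ ⟨f, k, hk, ⟨X, ⟨a⟩⟩, ⟨Y, ⟨b⟩⟩⟩
    obtain ⟨g, hg⟩ := F.map_surjective (a.hom ≫ f ≫ b.inv)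
    refine ⟨kernel g, ⟨PreservesKernel.iso F g ≪≫ kernel.mapIso _ _ a b (by simp [hg]) ≪≫
      (kernelIsKernel f).conePointUniqueUpToIso hk⟩⟩

lemma IsFullyFaithfulExact.essImage_isClosedUnderCokernels (hF : IsFullyFaithfulExact F) :
    F.essImage.IsClosedUnderCokernels where
  cokernels_le := by
    have := hF.preservesFiniteColimits
    have := hF.full
    rintro _ ⟨f, k, hk, ⟨X, ⟨a⟩⟩, ⟨Y, ⟨b⟩⟩⟩
    obtain ⟨g, hg⟩ := F.map_surjective (a.hom ≫ f ≫ b.inv)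
    refine ⟨cokernel g, ⟨PreservesCokernel.iso F g ≪≫ cokernel.mapIso _ _ a b (by simp [hg]) ≪≫
      (cokernelIsCokernel f).coconePointUniqueUpToIso hk⟩⟩

/-- An extension of `F Y` by `F X` is rebuilt in `C`: pulled back to a projective cover term `P ⟶ Y`
it splits, so it is the pushout of `0 → ker → P → Y → 0` along a map `ker ⟶ X`, and this map comes
from `C` by fullness. -/
lemma IsFullyFaithfulExact.essImage_isClosedUnderExtensions [EnoughProjectives C]
    [EnoughInjectives C] (hF : IsFullyFaithfulExact F) (hF' : ExtVanishes F 1) :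
    F.essImage.IsClosedUnderExtensions where
  prop_X₂_of_shortExact {S} hS := by
    have := hF.additive
    have := hF.preservesFiniteLimits
    have := hF.preservesFiniteColimits
    have := hF.full
    let _ := HasExt.standard D
    rintro ⟨X, ⟨a⟩⟩ ⟨Y, ⟨b⟩⟩
    let P : ProjectivePresentation Y := Classical.arbitrary _
    let T := ShortComplex.mk _ _ (kernel.condition P.f)
    have hP : Projective P.p := P.projective
    have hT : T.ShortExact := { exact := ShortComplex.exact_kernel P.f }
    -- The obstruction to lifting `F P ⟶ F Y` to the middle term lies in `Ext^1(F P, F X) = 0`.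
    obtain ⟨q, hq⟩ := Ext.covariant_sequence_exact₃ (F.obj P.p) hS
      (Ext.mk₀ (F.map P.f ≫ b.hom)) (zero_add 1)
      (ext_eq_zero_of_iso (Iso.refl _) a.symm
        (ext_eq_zero_of_forall_injective F 1 (fun i hi I hI e => by
          obtain rfl : i = 0 := by omega
          exact hF' _ _ hP hI e) 0 one_pos X) _)
    obtain ⟨q, rfl⟩ := (Ext.mk₀_bijective _ _).2 q
    rw [Ext.mk₀_comp_mk₀] at hq
    replace hq := (Ext.mk₀_bijective _ _).1 hq
    have := hS.mono_f
    have h₁ : (F.map T.f ≫ q) ≫ S.g = 0 := by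
      rw [Category.assoc, hq, ← F.map_comp_assoc, T.zero, F.map_zero, zero_comp]
    obtain ⟨t, ht⟩ := F.map_surjective (hS.exact.lift _ h₁ ≫ a.inv)
    have ht' : F.map T.f ≫ q = F.map t ≫ a.hom ≫ S.f := by simp [ht]
    have hE := (pushoutComplex_shortExact hT t).map_of_exact F
    -- `F` preserves the pushout, which gives the comparison map `d`; it is an isomorphism by the
    -- five lemma.
    let po := (IsPushout.of_hasPushout T.f t).map F
    let d : F.obj (pushout T.f t) ⟶ S.X₂ := po.desc q (a.hom ≫ S.f) ht'
    have hd₁ : F.map (pushout.inl T.f t) ≫ d = q := po.inl_desc _ _ _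
    have hd₂ : F.map (pushout.inr T.f t) ≫ d = a.hom ≫ S.f := po.inr_desc _ _ _
    have hd₃ : d ≫ S.g = F.map (pushoutComplex T t).g ≫ b.hom := by
      apply po.hom_ext
      · rw [reassoc_of% hd₁, hq, ← F.map_comp_assoc, pushout.inl_desc]
      · rw [reassoc_of% hd₂, S.zero, comp_zero, ← F.map_comp_assoc, pushout.inr_desc,
          F.map_zero, zero_comp]
    let φ : (pushoutComplex T t).map F ⟶ S :=
      { τ₁ := a.hom, τ₂ := d, τ₃ := b.hom, comm₁₂ := hd₂.symm, comm₂₃ := hd₃ }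
    have : IsIso φ.τ₁ := inferInstanceAs (IsIso a.hom)
    have : IsIso φ.τ₃ := inferInstanceAs (IsIso b.hom)
    have : IsIso d := ShortComplex.isIso₂_of_shortExact_of_isIso₁₃ φ hE hS
    exact ⟨_, ⟨asIso d⟩⟩

/-- If the essential image of `F` is closed under extensions then `F` induces isomorphisms
on `Ext^1`. -/
lemma IsFullyFaithfulExact.extVanishes_one [EnoughProjectives D] (hF : IsFullyFaithfulExact F)
    (h : F.essImage.IsClosedUnderExtensions) : ExtVanishes F 1 := by
  have := hF.full
  have := hF.faithful
  have := hF.preservesFiniteColimits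
  let _ := HasExt.standard D
  intro P I hP hI e
  let Q : ProjectivePresentation (F.obj P) := Classical.arbitrary _
  let S := ShortComplex.mk _ _ (kernel.condition Q.f)
  have hQ : Projective Q.p := Q.projective
  have hS : S.ShortExact := { exact := ShortComplex.exact_kernel Q.f }
  -- As `Ext^1(Q, F I) = 0`, the class `e` is the connecting image of a map `x` from the kernel to
  -- `F I`. By naturality it is the class of the pushout extension along `x`.
  obtain ⟨x, rfl⟩ := Ext.contravariant_sequence_exact₃ hS _ e
    (Ext.eq_zero_of_projective (n := 0) _) (add_zero 1)
  obtain ⟨x, rfl⟩ := (Ext.mk₀_bijective _ _).2 x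
  have hT := pushoutComplex_shortExact hS x
  have := hS.extClass_naturality hT (toPushoutComplex S x)
  refine this.trans ?_
  have h₁ : F.essImage (pushoutComplex S x).X₂ :=
    h.prop_X₂_of_shortExact hT (F.obj_mem_essImage I) (F.obj_mem_essImage P)
  obtain ⟨E, ⟨a⟩⟩ := h₁
  -- The middle term lies in the image, so its projection to `F P` comes from an epimorphism `g`
  -- onto `P`. Projectivity splits `g`, and the extension class vanishes.
  obtain ⟨g, hg⟩ := F.map_surjective (a.hom ≫ (pushoutComplex S x).g)
  have := hT.epi_g
  have : Epi (F.map g) := by rw [hg]; infer_instance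
  have : Epi g := F.epi_of_epi_map this
  have h₂ : 𝟙 (F.obj P) = (F.map (Projective.factorThru (𝟙 P) g) ≫ a.hom) ≫
      (pushoutComplex S x).g := by
    rw [Category.assoc, ← hg, ← F.map_comp, Projective.factorThru_comp, F.map_id]
  have h₃ := mk₀_comp_g_comp_extClass hT (F.map (Projective.factorThru (𝟙 P) g) ≫ a.hom)
  exact (congr((Ext.mk₀ $h₂).comp hT.extClass (zero_add 1))).trans h₃

end EssImage

/-! ### Functorial finiteness of the essential image -/

section Approximation

variable (K : Type u) {A B : Type u} [Field K] [Ring A] [Algebra K A] [Module.Finite K A]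
  [Ring B] [Algebra K B] [Module.Finite K B]
  [IsNoetherianRing B]
  {F : FGModuleCat.{u} B ⥤ FGModuleCat.{u} A}

omit [Algebra K B] [Module.Finite K B] in
include K in
-- `Q` is a sum of copies of `B`, one for each generator of `Hom_A(F B, X)`. The dual basis lemma
-- passes from `B` to any projective `P`.
lemma exists_projective_generating [F.Additive] (X : FGModuleCat.{u} A) :
    ∃ (Q : FGModuleCat.{u} B) (_ : Projective Q) (g : F.obj Q ⟶ X),
      ∀ (P : FGModuleCat.{u} B), Projective P → ∀ f : F.obj P ⟶ X,
        ∃ v : F.obj P ⟶ F.obj Q, v ≫ g = f := by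
  have := Abelian.hasFiniteBiproducts (C := FGModuleCat.{u} B)
  obtain ⟨n, f, hf⟩ := exists_finite_generators K (F.obj (regular B)) X
  let Q : FGModuleCat.{u} B := ⨁ fun _ : Fin n => regular B
  let g : F.obj Q ⟶ X := ∑ i, F.map (biproduct.π (fun _ : Fin n => regular B) i) ≫ f i
  have hg (i : Fin n) : F.map (biproduct.ι (fun _ : Fin n => regular B) i) ≫ g = f i := by
    rw [Preadditive.comp_sum, Finset.sum_eq_single i]
    · rw [← F.map_comp_assoc, biproduct.ι_π_self, F.map_id, Category.id_comp]
    · intro j _ hj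
      rw [← F.map_comp_assoc, biproduct.ι_π_ne _ hj.symm, F.map_zero, zero_comp]
    · simp
  have hQ : Projective Q :=
    ⟨fun f e _ => ⟨biproduct.desc fun b =>
      Projective.factorThru (biproduct.ι (fun _ : Fin n => regular B) b ≫ f) e, by
        apply biproduct.hom_ext'
        simp⟩⟩
  refine ⟨Q, hQ, g, fun P hP h => ?_⟩
  have key (h : F.obj (regular B) ⟶ X) : ∃ v, v ≫ g = h := by
    obtain ⟨c, hc, -⟩ := hf h
    refine ⟨∑ i, scalarEnd K (c i) _ ≫ F.map (biproduct.ι (fun _ : Fin n => regular B) i), ?_⟩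
    simp only [Preadditive.sum_comp, Category.assoc, hg]
    exact hc.symm
  obtain ⟨m, α, β, hαβ⟩ := exists_dual_basis P
  choose v hv using fun i => key (F.map (β i) ≫ h)
  refine ⟨∑ i, F.map (α i) ≫ v i, ?_⟩
  simp only [Preadditive.sum_comp, Category.assoc, hv]
  simp only [← Category.assoc, ← Preadditive.sum_comp, ← F.map_comp, ← F.map_sum, ← hαβ]
  simp

include K in
lemma exists_injective_cogenerating [F.Additive] (X : FGModuleCat.{u} A) :
    ∃ (J : FGModuleCat.{u} B) (_ : Injective J) (g : X ⟶ F.obj J),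
      ∀ (I : FGModuleCat.{u} B), Injective I → ∀ f : X ⟶ F.obj I,
        ∃ v : F.obj J ⟶ F.obj I, g ≫ v = f := by
  have := Abelian.hasFiniteBiproducts (C := FGModuleCat.{u} B)
  obtain ⟨n, f, hf⟩ := exists_finite_generators K X (F.obj (coinduced K B K))
  let J : FGModuleCat.{u} B := ⨁ fun _ : Fin n => coinduced K B K
  let g : X ⟶ F.obj J := ∑ i, f i ≫ F.map (biproduct.ι (fun _ : Fin n => coinduced K B K) i)
  have hg (i : Fin n) : g ≫ F.map (biproduct.π (fun _ : Fin n => coinduced K B K) i) = f i := by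
    rw [Preadditive.sum_comp, Finset.sum_eq_single i]
    · rw [Category.assoc, ← F.map_comp, biproduct.ι_π_self, F.map_id, Category.comp_id]
    · intro j _ hj
      rw [Category.assoc, ← F.map_comp, biproduct.ι_π_ne _ hj, F.map_zero, comp_zero]
    · simp
  refine ⟨J, inferInstance, g, fun P hP h => ?_⟩
  have key (h : X ⟶ F.obj (coinduced K B K)) : ∃ v, g ≫ v = h := by
    obtain ⟨c, -, hc⟩ := hf h
    refine ⟨∑ i, F.map (biproduct.π (fun _ : Fin n => coinduced K B K) i) ≫
      scalarEnd K (c i) _, ?_⟩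
    rw [Preadditive.comp_sum, hc]
    refine Finset.sum_congr rfl fun i _ => ?_
    rw [← Category.assoc, hg]
  obtain ⟨m, α, β, hαβ⟩ := exists_codual_basis K P
  choose v hv using fun i => key (h ≫ F.map (α i))
  refine ⟨∑ i, v i ≫ F.map (β i), ?_⟩
  simp only [Preadditive.comp_sum, ← Category.assoc, hv]
  simp only [Category.assoc, ← Preadditive.comp_sum, ← F.map_comp, ← F.map_sum, ← hαβ]
  simp

variable [IsNoetherianRing A]

include K in
-- For the left approximation, map `X` to `F J` and its cokernel to `F J'` universally (without
-- uniqueness) among images of injectives. The composite comes from `d : J ⟶ J'`, and `X ⟶ F (ker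
-- d)` is the approximation: a map `X ⟶ F T` extends to a map from `J ⟶ J'` to an injective
-- copresentation of `T`, hence to `ker d ⟶ T`. The right approximation is dual.
lemma IsFullyFaithfulExact.essImage_isFunctoriallyFinite (hF : IsFullyFaithfulExact F) :
    IsFunctoriallyFinite F.essImage := by
  have := hF.additive
  have := hF.preservesFiniteLimits
  have := hF.preservesFiniteColimits
  have := hF.full
  have := fg_enoughInjectives K (B := B)
  intro X
  constructor
  · obtain ⟨J, hJ, g, hg⟩ := exists_injective_cogenerating K (F := F) X
    obtain ⟨J', hJ', g', hg'⟩ := exists_injective_cogenerating K (F := F) (cokernel g)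
    obtain ⟨d, hd⟩ := F.map_surjective (cokernel.π g ≫ g')
    have hgd : g ≫ F.map d = 0 := by rw [hd, cokernel.condition_assoc, zero_comp]
    let s : X ⟶ F.obj (kernel d) := (isLimitForkMapOfIsLimit' F (kernel.condition d) (kernelIsKernel d)).lift
      (KernelFork.ofι g hgd)
    have hs : s ≫ F.map (kernel.ι d) = g :=
      (isLimitForkMapOfIsLimit' F (kernel.condition d) (kernelIsKernel d)).fac (KernelFork.ofι g hgd)
        WalkingParallelPair.zero
    refine ⟨F.obj (kernel d), F.obj_mem_essImage _, s, ?_⟩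
    rintro _ ⟨T, ⟨a⟩⟩ f
    let I := Injective.under T
    let I' := Injective.under (cokernel (Injective.ι T))
    let e : I ⟶ I' := cokernel.π (Injective.ι T) ≫ Injective.ι _
    have he : Injective.ι T ≫ e = 0 := by simp [e]
    obtain ⟨v, hv⟩ := hg I inferInstance (f ≫ a.inv ≫ F.map (Injective.ι T))
    have h₁ : g ≫ v ≫ F.map e = 0 := by
      rw [reassoc_of% hv, ← F.map_comp, he, F.map_zero, comp_zero, comp_zero]
    -- `v` extends `f` to `F J`; `w` extends it to `F J'`, so that `v` maps the kernel of `F.map d`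
    -- into that of `F.map e`.
    obtain ⟨w, hw⟩ := hg' I' inferInstance (cokernel.desc g (v ≫ F.map e) h₁)
    have hw' : F.map d ≫ w = v ≫ F.map e := by
      rw [hd, Category.assoc, hw, cokernel.π_desc]
    have h₂ : (F.map (kernel.ι d) ≫ v) ≫ F.map e = 0 := by
      rw [Category.assoc, ← hw', ← F.map_comp_assoc, kernel.condition, F.map_zero, zero_comp]
    obtain ⟨r, hr⟩ := F.map_surjective (F.map (kernel.ι d) ≫ v)
    have h₃ : r ≫ e = 0 := by
      have := hF.faithful
      apply F.map_injective
      rw [F.map_comp, hr, h₂, F.map_zero]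
    have h₄ : r ≫ cokernel.π (Injective.ι T) = 0 := by
      rw [← cancel_mono (Injective.ι (cokernel (Injective.ι T))), zero_comp, Category.assoc]
      exact h₃
    let l := (ShortComplex.exact_cokernel (Injective.ι T)).lift r h₄
    have hl : l ≫ Injective.ι T = r := (ShortComplex.exact_cokernel (Injective.ι T)).lift_f r h₄
    refine ⟨F.map l ≫ a.hom, ?_⟩
    rw [← cancel_mono a.inv, ← cancel_mono (F.map (Injective.ι T))]
    simp only [Category.assoc, Iso.hom_inv_id_assoc, ← F.map_comp, hl]
    rw [hr, reassoc_of% hs, hv]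
  · obtain ⟨Q, hQ, g, hg⟩ := exists_projective_generating K (F := F) X
    obtain ⟨Q', hQ', g', hg'⟩ := exists_projective_generating K (F := F) (kernel g)
    obtain ⟨d, hd⟩ := F.map_surjective (g' ≫ kernel.ι g)
    have hgd : F.map d ≫ g = 0 := by rw [hd, Category.assoc, kernel.condition, comp_zero]
    let s : F.obj (cokernel d) ⟶ X :=
      (isColimitCoforkMapOfIsColimit' F (cokernel.condition d) (cokernelIsCokernel d)).desc (CokernelCofork.ofπ g hgd)
    have hs : F.map (cokernel.π d) ≫ s = g :=
      (isColimitCoforkMapOfIsColimit' F (cokernel.condition d) (cokernelIsCokernel d)).fac (CokernelCofork.ofπ g hgd)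
        WalkingParallelPair.one
    refine ⟨F.obj (cokernel d), F.obj_mem_essImage _, s, ?_⟩
    rintro _ ⟨T, ⟨a⟩⟩ f
    let e : Projective.over (kernel (Projective.π T)) ⟶ Projective.over T :=
      Projective.π _ ≫ kernel.ι (Projective.π T)
    have he : e ≫ Projective.π T = 0 := by simp [e]
    obtain ⟨v, hv⟩ := hg (Projective.over T) inferInstance (F.map (Projective.π T) ≫ a.hom ≫ f)
    have h₁ : (F.map e ≫ v) ≫ g = 0 := by
      rw [Category.assoc, hv, ← F.map_comp_assoc, he, F.map_zero, zero_comp]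
    obtain ⟨w, hw⟩ := hg' _ inferInstance (kernel.lift g (F.map e ≫ v) h₁)
    have hw' : w ≫ F.map d = F.map e ≫ v := by
      rw [hd, reassoc_of% hw, kernel.lift_ι]
    obtain ⟨r, hr⟩ := F.map_surjective (v ≫ F.map (cokernel.π d))
    have h₃ : e ≫ r = 0 := by
      have := hF.faithful
      apply F.map_injective
      rw [F.map_comp, hr, ← reassoc_of% hw', ← F.map_comp, cokernel.condition, F.map_zero,
        comp_zero, F.map_zero]
    have h₄ : kernel.ι (Projective.π T) ≫ r = 0 := by
      rw [← cancel_epi (Projective.π (kernel (Projective.π T))), comp_zero, ← Category.assoc]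
      exact h₃
    let l := (ShortComplex.exact_kernel (Projective.π T)).desc r h₄
    have hl : Projective.π T ≫ l = r := (ShortComplex.exact_kernel (Projective.π T)).g_desc r h₄
    refine ⟨a.inv ≫ F.map l, ?_⟩
    dsimp only
    rw [← cancel_epi a.hom, ← cancel_epi (F.map (Projective.π T))]
    rw [Category.assoc, Iso.hom_inv_id_assoc, ← F.map_comp_assoc, hl, hr, Category.assoc, hs, hv]

omit [Algebra K A] [Module.Finite K A] in
include K in
/-- The essential image of a weakly homological embedding is functorially finite and wide. -/
lemma IsFullyFaithfulExact.isWide_essImage (hF : IsFullyFaithfulExact F) (hF' : ExtVanishes F 1) :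
    IsWide F.essImage := by
  have := hF.additive
  have := fg_enoughInjectives K (B := B)
  obtain ⟨Z, hZ⟩ := HasZeroObject.zero (C := FGModuleCat.{u} B)
  exact ⟨⟨F.obj Z, F.map_isZero hZ, F.obj_mem_essImage _⟩,
    hF.essImage_isClosedUnderKernels, hF.essImage_isClosedUnderCokernels,
    hF.essImage_isClosedUnderExtensions hF'⟩

end Approximation


/-! ### Restriction functors and ring epimorphisms -/

variable {K A : Type u} [Field K] [Ring A] [Algebra K A]

namespace AlgebraUnder

variable (R : AlgebraUnder K A)

/-- The restriction functor `mod(B) ⥤ mod(A)`. -/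
def resFunctor : FGModuleCat.{u} R.B ⥤ FGModuleCat.{u} A := R.restriction.functor

/-- A morphism between restrictions, from an additive map compatible with the action of `A`. -/
def resHom {M N : FGModuleCat.{u} R.B} (f : M →+ N)
    (hf : ∀ (a : A) (m : M), f (R.hom a • m) = R.hom a • f m) :
    R.resFunctor.obj M ⟶ R.resFunctor.obj N :=
  fgHom (X := R.resFunctor.obj M) (Y := R.resFunctor.obj N)
    { toFun := f, map_add' := map_add f, map_smul' := hf }

instance : R.resFunctor.Faithful where
  map_injective h := fgHom_ext fun x => congr(($h).hom.hom x)

lemma map_smul_of_full (h : R.resFunctor.Full) {M N : FGModuleCat.{u} R.B} (f : M →+ N)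
    (hf : ∀ (a : A) (m : M), f (R.hom a • m) = R.hom a • f m) (b : R.B) (m : M) :
    f (b • m) = b • f m := by
  obtain ⟨g, hg⟩ := h.map_surjective (R.resHom f hf)
  have hg' (m : M) : g.hom.hom m = f m := congr(($hg).hom.hom m)
  rw [← hg', map_smul, hg']

/-- Conjugate the action of `B` on `M × N` by the unipotent automorphism `(m, n) ↦ (m, n + g m)`. As
`g` is `A`-linear, the two ring homomorphisms from `B` agree on `A`, hence everywhere; evaluating at
`(m, 0)` gives `g (b • m) = b • g m`. -/
lemma full_of_isRingEpi (h : R.IsRingEpi) : R.resFunctor.Full where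
  map_surjective {M N} g := by
    let g' : M →+ N := g.hom.hom.toAddMonoidHom
    have hg' (a : A) (m : M) : g' (R.hom a • m) = R.hom a • g' m := g.hom.hom.map_smul a m
    let s : R.B →+* AddMonoid.End (M × N) := Module.toAddMonoidEnd R.B (M × N)
    let u : M × N →+ M × N := (AddMonoidHom.fst M N).prod
      (AddMonoidHom.snd M N + g'.comp (AddMonoidHom.fst M N))
    let v : M × N →+ M × N := (AddMonoidHom.fst M N).prod
      (AddMonoidHom.snd M N - g'.comp (AddMonoidHom.fst M N))
    have huv (x) : u (v x) = x := by ext <;> simp [u, v]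
    have hvu (x) : v (u x) = x := by ext <;> simp [u, v]
    let t : R.B →+* AddMonoid.End (M × N) :=
      { toFun := fun b => u.comp ((s b).comp v)
        map_zero' := by
          ext x : 1
          change u (s 0 (v x)) = 0
          rw [map_zero]
          exact map_zero u
        map_one' := by
          ext x : 1
          change u (s 1 (v x)) = x
          rw [map_one]
          exact huv x
        map_add' := fun b c => by
          ext x : 1
          change u (s (b + c) (v x)) = u (s b (v x)) + u (s c (v x))
          rw [map_add, ← map_add u]
          rfl
        map_mul' := fun b c => by
          ext x : 1
          change u (s (b * c) (v x)) = u (s b (v (u (s c (v x)))))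
          rw [map_mul, hvu]
          rfl }
    have hst : RingCat.ofHom s = RingCat.ofHom t := by
      have : Epi (RingCat.ofHom (R.hom : A →+* R.B)) := h
      rw [← cancel_epi (RingCat.ofHom (R.hom : A →+* R.B))]
      ext a : 2
      change s (R.hom a) = t (R.hom a)
      ext x : 1
      change R.hom a • x = u (R.hom a • v x)
      ext
      · rfl
      · change R.hom a • x.2 = R.hom a • (x.2 - g' x.1) + g' (R.hom a • x.1)
        rw [hg', smul_sub, sub_add_cancel]
    have key (b : R.B) (m : M) : g' (b • m) = b • g' m := by
      have := congr((($hst).hom b (m, (0 : N))).2)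
      change b • (0 : N) = b • (0 - g' m) + g' (b • m) at this
      rw [smul_zero, zero_sub, smul_neg] at this
      exact (neg_add_eq_zero.1 this.symm).symm
    exact ⟨fgHom { g' with map_smul' := key }, rfl⟩

/-- If `g` and `h` agree on `A`, let `B` act on `S` through `g`. Then `h` is `A`-linear, hence
`B`-linear by fullness, and `h b = g b * h 1 = g b`. -/
lemma isRingEpi_of_full (hR : R.resFunctor.Full) : R.IsRingEpi where
  left_cancellation {S} g h hgh := by
    have hgh' (a : A) : g.hom (R.hom a) = h.hom (R.hom a) := congr(($hgh).hom a)
    let _ : Module R.B S := Module.compHom S g.hom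
    obtain ⟨s, hs⟩ := (inferInstance : Module.Finite K R.B)
    classical
    -- Fullness concerns finitely generated modules only, so `S` is replaced by the submodule
    -- generated by the image under `h` of a finite `K`-spanning set. It contains all of `h(B)`
    -- because `g` and `h` agree on scalars, which come from `A`.
    let T : Submodule R.B S := Submodule.span R.B (s.image h.hom)
    have hT (b : R.B) : h.hom b ∈ T := by
      have hb : b ∈ Submodule.span K (s : Set R.B) := by rw [hs]; trivial
      induction hb using Submodule.span_induction with
      | mem x hx => exact Submodule.subset_span (Finset.mem_coe.2 (Finset.mem_image_of_mem _ hx))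
      | zero => rw [map_zero]; exact zero_mem _
      | add x y _ _ hx hy => rw [map_add]; exact add_mem hx hy
      | smul k x _ hx =>
        have h₁ : h.hom (k • x) = algebraMap K R.B k • h.hom x := by
          change _ = g.hom (algebraMap K R.B k) * h.hom x
          rw [← R.hom.commutes, hgh', ← map_mul, R.hom.commutes, Algebra.smul_def]
        rw [h₁]
        exact T.smul_mem _ hx
    have : Module.Finite R.B T := Module.Finite.iff_fg.2 ⟨_, rfl⟩
    let N : FGModuleCat.{u} R.B := FGModuleCat.of R.B T
    let f : regular R.B →+ N :=
      { toFun := fun b => (⟨h.hom b, hT b⟩ : T)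
        map_zero' := Subtype.ext (map_zero h.hom)
        map_add' := fun b c => Subtype.ext (map_add h.hom _ _) }
    have hf := R.map_smul_of_full hR f fun a b => Subtype.ext (by
      change h.hom (R.hom a * b) = g.hom (R.hom a) * h.hom b
      rw [map_mul, hgh'])
    ext b
    have h₃ : h.hom (b * 1) = g.hom b * h.hom 1 := congrArg Subtype.val (hf b (1 : R.B))
    rw [mul_one, map_one, mul_one] at h₃
    exact h₃.symm

lemma preservesFiniteLimits_restriction [IsNoetherianRing A] [IsNoetherianRing R.B] :
    PreservesFiniteLimits R.resFunctor := by
  let ι := forget₂ (FGModuleCat.{u} A) (ModuleCat.{u} A)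
  let φ := forget₂ (ModuleCat.{u} A) AddCommGrpCat.{u}
  have : PreservesFiniteLimits (ModuleCat.restrictScalars (R.hom : A →+* R.B) ⋙ φ) :=
    inferInstanceAs (PreservesFiniteLimits (forget₂ (ModuleCat.{u} R.B) AddCommGrpCat.{u}))
  have : ReflectsFiniteLimits φ := ⟨fun J _ _ => reflectsLimitsOfShape_of_reflectsIsomorphisms⟩
  have : PreservesFiniteLimits (ModuleCat.restrictScalars (R.hom : A →+* R.B)) :=
    preservesFiniteLimits_of_reflects_of_preserves _ φ
  have : PreservesFiniteLimits (forget₂ (FGModuleCat.{u} R.B) (ModuleCat.{u} R.B) ⋙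
      ModuleCat.restrictScalars (R.hom : A →+* R.B)) := comp_preservesFiniteLimits _ _
  have : PreservesFiniteLimits (R.resFunctor ⋙ ι) := this
  have : ReflectsFiniteLimits ι :=
    inferInstanceAs (ReflectsFiniteLimits (ModuleCat.isFG A).ι)
  exact preservesFiniteLimits_of_reflects_of_preserves _ ι

lemma preservesFiniteColimits_restriction [IsNoetherianRing A] [IsNoetherianRing R.B] :
    PreservesFiniteColimits R.resFunctor := by
  let ι := forget₂ (FGModuleCat.{u} A) (ModuleCat.{u} A)
  have : PreservesFiniteColimits (forget₂ (FGModuleCat.{u} R.B) (ModuleCat.{u} R.B) ⋙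
      ModuleCat.restrictScalars (R.hom : A →+* R.B)) := comp_preservesFiniteColimits _ _
  have : PreservesFiniteColimits (R.resFunctor ⋙ ι) := this
  have : ReflectsFiniteColimits ι :=
    inferInstanceAs (ReflectsFiniteColimits (ModuleCat.isFG A).ι)
  exact preservesFiniteColimits_of_reflects_of_preserves _ ι

lemma isFullyFaithfulExact_restriction_iff [IsNoetherianRing A] [IsNoetherianRing R.B] :
    IsFullyFaithfulExact R.resFunctor ↔ R.IsRingEpi :=
  ⟨fun h => R.isRingEpi_of_full h.full, fun h => ⟨R.full_of_isRingEpi h, inferInstance,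
    R.preservesFiniteLimits_restriction, R.preservesFiniteColimits_restriction⟩⟩

/-- Two ring epimorphisms whose restriction functors have the same essential image are
equivalent. -/
lemma equivalent_of_essImage_eq {R R' : AlgebraUnder K A} (hR : R.IsRingEpi) (hR' : R'.IsRingEpi)
    (h : R.resFunctor.essImage = R'.resFunctor.essImage) : R.Equivalent R' := by
  have key (R R' : AlgebraUnder K A) (hR' : R'.IsRingEpi)
      (h : R.resFunctor.essImage = R'.resFunctor.essImage) :
      ∃ g : R'.B →ₐ[K] R.B, g.comp R'.hom = R.hom := by
    obtain ⟨M, ⟨e⟩⟩ : R'.resFunctor.essImage (R.resFunctor.obj (regular R.B)) :=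
      h ▸ R.resFunctor.obj_mem_essImage _
    let e' : M ≃+ R.B := (FGModuleCat.isoToLinearEquiv e).toAddEquiv
    have he (a : A) (m : M) : e' (R'.hom a • m) = R.hom a * e' m :=
      (FGModuleCat.isoToLinearEquiv e).map_smul a m
    have he' (a : A) (b : R.B) : e'.symm (R.hom a * b) = R'.hom a • e'.symm b :=
      (FGModuleCat.isoToLinearEquiv e).symm.map_smul a b
    let one : M := e'.symm 1
    have h_one : e' one = 1 := e'.apply_symm_apply 1
    -- Right multiplication by `c` on `R.B` is `A`-linear; transported to `M` it is therefore
    -- `R'.B`-linear. This makes `b ↦ b • 1` multiplicative.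
    have comm (b : R'.B) (m : M) (c : R.B) :
        e' (b • m) * c = e' (b • e'.symm (e' m * c)) := by
      let r : M →+ M := e'.symm.toAddMonoidHom.comp ((AddMonoidHom.mulRight c).comp
        e'.toAddMonoidHom)
      have := R'.map_smul_of_full (R'.full_of_isRingEpi hR') r (fun a x => by
        change e'.symm (e' (R'.hom a • x) * c) = R'.hom a • e'.symm (e' x * c)
        rw [he, mul_assoc, he']) b m
      exact e'.symm_apply_eq.1 this
    let g (b : R'.B) : R.B := e' (b • one)
    have hg (a : A) : g (R'.hom a) = R.hom a := by
      refine (he a one).trans ?_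
      rw [h_one, mul_one]
    have gmul (b c : R'.B) : g (b * c) = g b * g c := by
      refine Eq.trans ?_ (comm b one (g c)).symm
      rw [h_one, one_mul]
      change e' _ = e' (b • e'.symm (e' (c • one)))
      rw [e'.symm_apply_apply, mul_smul]
    have gadd (b c : R'.B) : g (b + c) = g b + g c :=
      (congrArg e' (add_smul b c one)).trans (map_add e' _ _)
    let G : R'.B →+* R.B :=
      { toFun := g
        map_one' := by rw [← map_one R'.hom, hg, map_one]
        map_mul' := gmul
        map_zero' := by rw [← map_zero R'.hom, hg, map_zero]
        map_add' := gadd }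
    refine ⟨{ toRingHom := G, commutes' := fun k => ?_ }, AlgHom.ext hg⟩
    change g _ = _
    rw [← R'.hom.commutes, hg, R.hom.commutes]
  have cancel (R : AlgebraUnder K A) (hR : R.IsRingEpi) (g : R.B →ₐ[K] R.B)
      (hg : g.comp R.hom = R.hom) : g = AlgHom.id K R.B := by
    have : Epi (RingCat.ofHom (R.hom : A →+* R.B)) := hR
    have h₁ : RingCat.ofHom (R.hom : A →+* R.B) ≫ RingCat.ofHom (g : R.B →+* R.B) =
        RingCat.ofHom (R.hom : A →+* R.B) ≫ 𝟙 _ := by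
      ext a
      exact congr($hg a)
    rw [cancel_epi] at h₁
    ext b
    exact congr(($h₁).hom b)
  obtain ⟨g, hg⟩ := key R R' hR' h
  obtain ⟨g', hg'⟩ := key R' R hR h.symm
  exact ⟨AlgEquiv.ofAlgHom g g'
    (cancel R hR _ (by rw [AlgHom.comp_assoc, hg', hg]))
    (cancel R' hR' _ (by rw [AlgHom.comp_assoc, hg, hg'])), hg⟩

end AlgebraUnder


/-- A bijective morphism of finitely generated modules is an isomorphism. -/
def isoOfBijective {A : Type u} [Ring A] {X Y : FGModuleCat.{u} A} (f : X ⟶ Y)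
    (hf : Function.Bijective f.hom.hom) : X ≅ Y where
  hom := f
  inv := fgHom (LinearEquiv.ofBijective f.hom.hom hf).symm.toLinearMap
  hom_inv_id := fgHom_ext fun x => (LinearEquiv.ofBijective f.hom.hom hf).symm_apply_apply x
  inv_hom_id := fgHom_ext fun x => (LinearEquiv.ofBijective f.hom.hom hf).apply_symm_apply x

/-! ### The universal map from `A` to a functorially finite subcategory -/

section Reflection

variable {A : Type u} [Ring A]

/-- An object `X` of the subcategory `W` is free on `x : X` if every element of an object `T` of `W`
is the image of `x` under a unique morphism from `X`. -/
structure IsFreeOn (W : ObjectProperty (FGModuleCat.{u} A)) (X : FGModuleCat.{u} A) (x : X) :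
    Prop where
  mem : W X
  existsUnique (T : FGModuleCat.{u} A) (hT : W T) (t : T) : ∃! f : X →ₗ[A] T, f x = t

/-- Take a left approximation `g : A ⟶ X` of minimal dimension. If two maps agree on `g 1`, their
difference `d` kills `g`, so `g` factors through `ker d`, which lies in `W` and again gives an
approximation. Minimality forces `ker d = X`, that is `d = 0`. -/
lemma exists_isFreeOn (K : Type u) [Field K] [Algebra K A] [Module.Finite K A]
    [IsNoetherianRing A] {W : ObjectProperty (FGModuleCat.{u} A)}
    (hW : IsFunctoriallyFinite W) (hW' : W.IsClosedUnderKernels) :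
    ∃ (X : FGModuleCat.{u} A) (x : X), IsFreeOn W X x := by
  let dim (X : FGModuleCat.{u} A) : ℕ := letI := scalarModule K X; Module.finrank K X
  let good (X : FGModuleCat.{u} A) (g : regular A ⟶ X) : Prop :=
    W X ∧ ∀ T, W T → Function.Surjective (fun h : X ⟶ T => g ≫ h)
  have ex : ∃ n, ∃ X g, good X g ∧ dim X = n := by
    obtain ⟨⟨X, hX, g, hg⟩, -⟩ := hW (regular A)
    exact ⟨_, X, g, ⟨hX, hg⟩, rfl⟩
  classical
  obtain ⟨X, g, ⟨hX, hg⟩, hn⟩ := Nat.find_spec ex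
  have hmin {Y : FGModuleCat.{u} A} {g' : regular A ⟶ Y} (h : good Y g') : dim X ≤ dim Y := by
    rw [hn]
    exact Nat.find_min' ex ⟨Y, g', h, rfl⟩
  refine ⟨X, g.hom.hom (1 : A), hX, fun T hT t => ?_⟩
  obtain ⟨f, hf⟩ := hg T hT (fgHom (LinearMap.toSpanSingleton A T t))
  refine ⟨f.hom.hom, ?_, fun f' hf' => ?_⟩
  · refine (congr(($hf).hom.hom (1 : A))).trans ?_
    exact one_smul A t
  · let d := fgHom f' - f
    have hd : g ≫ d = 0 := by
      rw [Preadditive.comp_sub, sub_eq_zero]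
      refine fgHom_ext fun (a : A) => ?_
      change f' (g.hom.hom a) = f.hom.hom (g.hom.hom a)
      have h₁ : g.hom.hom a = a • g.hom.hom (1 : A) := by
        rw [← map_smul, smul_eq_mul, mul_one]
      have h₂ : f.hom.hom (g.hom.hom (1 : A)) = t :=
        (congr(($hf).hom.hom (1 : A))).trans (one_smul A t)
      rw [h₁, map_smul, map_smul, h₂, hf']
    have hgood : good (kernel d) (kernel.lift d g hd) := by
      refine ⟨W.prop_kernel d hX hT, fun S hS s => ?_⟩
      obtain ⟨r, hr⟩ := hg S hS s
      exact ⟨kernel.ι d ≫ r, by simpa using hr⟩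
    have hle := hmin hgood
    let _ := scalarModule K X
    let _ := scalarModule K (kernel d)
    have := scalarModule_isScalarTower K X
    have := scalarModule_isScalarTower K (kernel d)
    have := scalarModule_finite K X
    have := scalarModule_finite K (kernel d)
    have hinj := fg_injective_of_mono (kernel.ι d)
    have hsurj : Function.Surjective ((kernel.ι d).hom.hom.restrictScalars K) :=
      ((kernel.ι d).hom.hom.restrictScalars K).injective_iff_surjective_of_finrank_eq_finrank
        (le_antisymm (LinearMap.finrank_le_finrank_of_injective
          (f := (kernel.ι d).hom.hom.restrictScalars K) hinj) hle) |>.1 hinj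
    have : Epi (kernel.ι d) := fg_epi_of_surjective _ hsurj
    have hd0 : d = 0 := by rw [← cancel_epi (kernel.ι d), kernel.condition, comp_zero]
    exact congr(($(sub_eq_zero.1 hd0)).hom.hom)

namespace IsFreeOn

variable {W : ObjectProperty (FGModuleCat.{u} A)} {X : FGModuleCat.{u} A} {x : X}
  (h : IsFreeOn W X x)

include h

lemma hom_ext {T : FGModuleCat.{u} A} (hT : W T) {f g : X →ₗ[A] T} (hfg : f x = g x) : f = g :=
  (h.existsUnique T hT (g x)).unique hfg rfl

/-- The unique morphism from the free object with a given value. -/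
def desc {T : FGModuleCat.{u} A} (hT : W T) (t : T) : X →ₗ[A] T := (h.existsUnique T hT t).choose

@[simp]
lemma desc_self {T : FGModuleCat.{u} A} (hT : W T) (t : T) : h.desc hT t x = t :=
  (h.existsUnique T hT t).choose_spec.1

lemma eq_desc {T : FGModuleCat.{u} A} (hT : W T) (f : X →ₗ[A] T) : f = h.desc hT (f x) :=
  h.hom_ext hT (h.desc_self hT _).symm

end IsFreeOn

end Reflection

/-! ### The ring epimorphism attached to a wide subcategory -/

section EndAlgebra

variable {K A : Type u} [Field K] [Ring A] [Algebra K A]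

/-- The `K`-algebra of endomorphisms of an `A`-module. -/
abbrev endAlgebra (K : Type u) [Field K] [Algebra K A] (X : FGModuleCat.{u} A) :
    Algebra K (Module.End A X) :=
  letI := scalarModule K X
  haveI := scalarModule_isScalarTower K X
  haveI : SMulCommClass A K X := ⟨fun b k y => by
    change b • algebraMap K A k • y = algebraMap K A k • b • y
    simp only [← mul_smul, Algebra.commutes]⟩
  haveI : SMulCommClass K A X := SMulCommClass.symm _ _ _
  inferInstance

lemma endAlgebra_finite [Module.Finite K A] (X : FGModuleCat.{u} A) :
    letI := endAlgebra K X
    Module.Finite K (Module.End A X) := by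
  let _ := scalarModule K X
  have := scalarModule_isScalarTower K X
  have := scalarModule_finite K X
  have : SMulCommClass A K X := ⟨fun b k y => by
    change b • algebraMap K A k • y = algebraMap K A k • b • y
    simp only [← mul_smul, Algebra.commutes]⟩
  exact Module.Finite.of_injective (LinearMap.restrictScalarsₗ K A X X K)
    (LinearMap.restrictScalars_injective K)

variable [Module.Finite K A] {W : ObjectProperty (FGModuleCat.{u} A)} {X : FGModuleCat.{u} A} {x : X}

namespace IsFreeOn

variable (K) in
/-- The ring homomorphism from `A` to the opposite of the endomorphism algebra of the
reflection of `A` in `W`. -/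
def algebraUnder (h : IsFreeOn W X x) : AlgebraUnder K A :=
  letI := endAlgebra K X
  haveI := endAlgebra_finite (K := K) X
  { B := (Module.End A X)ᵐᵒᵖ
    hom :=
      -- Applying first `x ↦ a • x` and then `x ↦ b • x` sends `x` to `(a * b) • x`: the order of
      -- composition is reversed, whence the opposite ring.
      { toFun := fun a => MulOpposite.op (h.desc h.mem (a • x))
        map_one' := congrArg MulOpposite.op (h.hom_ext h.mem (by simp))
        map_mul' := fun a b => by
          rw [← MulOpposite.op_mul]
          refine congrArg MulOpposite.op (h.hom_ext h.mem ?_)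
          simp [mul_smul]
        map_zero' := congrArg MulOpposite.op (h.hom_ext h.mem (by simp))
        map_add' := fun a b => by
          rw [← MulOpposite.op_add]
          exact congrArg MulOpposite.op (h.hom_ext h.mem (by simp [add_smul]))
        commutes' := fun k => congrArg MulOpposite.op (h.hom_ext h.mem (by simp; rfl)) } }

variable (h : IsFreeOn W X x)

/-- The elements of the algebra, as endomorphisms. -/
def toEnd (b : (h.algebraUnder K).B) : Module.End A X := MulOpposite.unop (α := Module.End A X) b

lemma toEnd_injective {b c : (h.algebraUnder K).B} (hbc : h.toEnd b x = h.toEnd c x) : b = c :=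
  MulOpposite.unop_injective (α := Module.End A X) (h.hom_ext h.mem hbc)

lemma toEnd_add (b c : (h.algebraUnder K).B) : h.toEnd (b + c) = h.toEnd b + h.toEnd c := rfl

lemma toEnd_zero : h.toEnd (0 : (h.algebraUnder K).B) = 0 := rfl

lemma toEnd_one : h.toEnd (1 : (h.algebraUnder K).B) = 1 := rfl

lemma toEnd_mul_apply (b c : (h.algebraUnder K).B) (y : X) :
    h.toEnd (b * c) y = h.toEnd c (h.toEnd b y) := rfl

lemma toEnd_hom (a : A) : h.toEnd ((h.algebraUnder K).hom a) = h.desc h.mem (a • x) := rfl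

lemma toEnd_hom_mul (a : A) (b : (h.algebraUnder K).B) :
    h.toEnd ((h.algebraUnder K).hom a * b) x = a • h.toEnd b x := by
  rw [toEnd_mul_apply, toEnd_hom, desc_self, map_smul]

variable (K) in
/-- The reflection of `A` is the regular module. -/
def regularEquiv : (h.algebraUnder K).resFunctor.obj (regular _) ≃ₗ[A] X :=
  LinearEquiv.ofBijective
    ({ toFun := fun b => h.toEnd (K := K) b x
       map_add' := fun _ _ => rfl
       map_smul' := fun a b => h.toEnd_hom_mul a b } :
      (h.algebraUnder K).resFunctor.obj (regular _) →ₗ[A] X)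
    ⟨fun _ _ hbc => h.toEnd_injective hbc,
      fun y => ⟨MulOpposite.op (h.desc h.mem y), h.desc_self h.mem y⟩⟩

lemma prop_regular [W.IsClosedUnderIsomorphisms] :
    W ((h.algebraUnder K).resFunctor.obj (regular _)) :=
  W.prop_of_iso (LinearEquiv.toFGModuleCatIso (h.regularEquiv K)).symm h.mem

variable (K) in
/-- The action of the algebra on an object of `W`. -/
abbrev moduleOf {T : FGModuleCat.{u} A} (hT : W T) : Module (h.algebraUnder K).B T where
  -- Evaluation at `x` identifies `T` with `Hom_A(X, T)`, on which endomorphisms of `X` act by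
  -- precomposition.
  smul b t := h.desc hT t (h.toEnd b x)
  one_smul t := by
    change h.desc hT t (h.toEnd (1 : (h.algebraUnder K).B) x) = t
    simp [toEnd_one]
  mul_smul b c t := by
    change h.desc hT t (h.toEnd (b * c) x) = h.desc hT (h.desc hT t (h.toEnd c x)) (h.toEnd b x)
    rw [toEnd_mul_apply]
    exact congr($(h.eq_desc hT ((h.desc hT t).comp (h.toEnd c))) _)
  smul_zero b := by
    change h.desc hT 0 (h.toEnd b x) = 0
    rw [h.hom_ext hT (f := h.desc hT (0 : T)) (g := 0) (by simp), LinearMap.zero_apply]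
  smul_add b s t := by
    change h.desc hT (s + t) (h.toEnd b x) = h.desc hT s (h.toEnd b x) + h.desc hT t (h.toEnd b x)
    rw [h.hom_ext hT (f := h.desc hT (s + t)) (g := h.desc hT s + h.desc hT t) (by simp),
      LinearMap.add_apply]
  add_smul b c t := by
    change h.desc hT t (h.toEnd (b + c) x) = _
    rw [toEnd_add, LinearMap.add_apply, map_add]
    rfl
  zero_smul t := by
    change h.desc hT t (h.toEnd (0 : (h.algebraUnder K).B) x) = 0
    simp [toEnd_zero]

lemma essImage_of_prop {T : FGModuleCat.{u} A} (hT : W T) :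
    (h.algebraUnder K).resFunctor.essImage T := by
  let R := h.algebraUnder K
  let _ := h.moduleOf K hT
  let _ : Module A R.B := Module.compHom R.B (R.hom : A →+* R.B)
  have hsmul (a : A) (t : T) : R.hom a • t = a • t := by
    change h.desc hT t (h.toEnd (R.hom a) x) = a • t
    rw [toEnd_hom, desc_self, map_smul, desc_self]
  have : IsScalarTower A R.B T := ⟨fun a b t => by
    rw [← hsmul a (b • t)]
    exact mul_smul (R.hom a) b t⟩
  have : Module.Finite R.B T := Module.Finite.of_restrictScalars_finite A R.B T
  let N : FGModuleCat.{u} R.B := FGModuleCat.of R.B T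
  let f : R.resFunctor.obj N →ₗ[A] T :=
    { toFun := fun t => t, map_add' := fun _ _ => rfl, map_smul' := hsmul }
  have hf : Function.Bijective f := ⟨fun _ _ hst => hst, fun t => ⟨t, rfl⟩⟩
  exact ⟨N, ⟨isoOfBijective (fgHom (X := R.resFunctor.obj N) f) hf⟩⟩

/-- Each element `m` is hit by a copy of the regular module, and `W` is closed under biproducts,
being closed under extensions. -/
lemma exists_epi_of_finset [IsNoetherianRing A] [IsNoetherianRing (h.algebraUnder K).B]
    (hW : IsWide W) [W.IsClosedUnderIsomorphisms]
    (M : FGModuleCat.{u} (h.algebraUnder K).B) (s : Finset M) :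
    ∃ (Q : FGModuleCat.{u} (h.algebraUnder K).B) (_ : W ((h.algebraUnder K).resFunctor.obj Q))
      (g : Q ⟶ M), ∀ m ∈ s, m ∈ Set.range g.hom.hom := by
  let R := h.algebraUnder K
  have := hW.extensions
  have := R.preservesFiniteLimits_restriction
  have := preservesBinaryBiproducts_of_preservesBinaryProducts R.resFunctor
  have : R.resFunctor.Additive := Functor.additive_of_preservesBinaryBiproducts _
  classical
  induction s using Finset.induction_on with
  | empty =>
    obtain ⟨Z, hZ⟩ := HasZeroObject.zero (C := FGModuleCat.{u} R.B)
    obtain ⟨Z', hZ', hWZ'⟩ := hW.containsZero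
    exact ⟨Z, W.prop_of_iso (hZ'.iso (R.resFunctor.map_isZero hZ)) hWZ', 0, by simp⟩
  | insert m s _ ih =>
    obtain ⟨Q, hQ, g, hg⟩ := ih
    let f : regular R.B ⟶ M := fgHom (LinearMap.toSpanSingleton R.B M m)
    refine ⟨regular R.B ⊞ Q, W.prop_of_iso (R.resFunctor.mapBiprod _ _).symm
      (W.prop_biprod h.prop_regular hQ), biprod.desc f g, fun y hy => ?_⟩
    obtain rfl | hy := Finset.mem_insert.1 hy
    · refine ⟨(biprod.inl (C := FGModuleCat.{u} R.B)).hom.hom (1 : R.B), ?_⟩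
      refine (congr(($(biprod.inl_desc f g)).hom.hom (1 : R.B))).trans ?_
      exact one_smul R.B y
    · obtain ⟨q, rfl⟩ := hg y hy
      exact ⟨(biprod.inr (C := FGModuleCat.{u} R.B)).hom.hom q,
        congr(($(biprod.inr_desc f g)).hom.hom q)⟩

lemma exists_epi [IsNoetherianRing A] [IsNoetherianRing (h.algebraUnder K).B]
    (hW : IsWide W) [W.IsClosedUnderIsomorphisms] (M : FGModuleCat.{u} (h.algebraUnder K).B) :
    ∃ (Q : FGModuleCat.{u} (h.algebraUnder K).B) (g : Q ⟶ M),
      W ((h.algebraUnder K).resFunctor.obj Q) ∧ Epi g := by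
  obtain ⟨s, hs⟩ := (inferInstance : Module.Finite (h.algebraUnder K).B M)
  obtain ⟨Q, hQ, g, hg⟩ := h.exists_epi_of_finset hW M s
  refine ⟨Q, g, hQ, fg_epi_of_surjective g ?_⟩
  rw [← LinearMap.range_eq_top, eq_top_iff, ← hs, Submodule.span_le]
  exact fun m hm => hg m hm

/-- A `B`-module is the cokernel of a map between modules whose restrictions lie in `W`. Restriction
is right exact and `W` is closed under cokernels. -/
lemma essImage_eq [IsNoetherianRing A] [IsNoetherianRing (h.algebraUnder K).B]
    (hW : IsWide W) [W.IsClosedUnderIsomorphisms] :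
    (h.algebraUnder K).resFunctor.essImage = W := by
  refine le_antisymm ?_ fun T hT => h.essImage_of_prop hT
  rintro T ⟨M, ⟨e⟩⟩
  refine W.prop_of_iso e ?_
  have := (h.algebraUnder K).preservesFiniteColimits_restriction
  have := hW.cokernels
  obtain ⟨Q, g, hQ, hg⟩ := h.exists_epi hW M
  obtain ⟨Q', g', hQ', hg'⟩ := h.exists_epi hW (kernel g)
  have ex : (ShortComplex.mk (g' ≫ kernel.ι g) g (by simp)).Exact := by
    let φ : ShortComplex.mk (g' ≫ kernel.ι g) g (by simp) ⟶
        ShortComplex.mk (kernel.ι g) g (by simp) :=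
      { τ₁ := g', τ₂ := 𝟙 _, τ₃ := 𝟙 _ }
    have : Epi φ.τ₁ := hg'
    have : IsIso φ.τ₂ := inferInstanceAs (IsIso (𝟙 _))
    have : Mono φ.τ₃ := inferInstanceAs (Mono (𝟙 _))
    exact (ShortComplex.exact_iff_of_epi_of_isIso_of_mono φ).2 (ShortComplex.exact_kernel g)
  have hc : IsColimit (CokernelCofork.ofπ g (by simp : (g' ≫ kernel.ι g) ≫ g = 0)) :=
    ex.gIsCokernel
  exact W.prop_of_isColimit_cokernelCofork
    (isColimitCoforkMapOfIsColimit' (h.algebraUnder K).resFunctor _ hc) hQ' hQ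

/-- For `m` in `M`, the `A`-linear maps `b ↦ g (b • m)` and `b ↦ b • g m` from `B ≅ X` to `N` agree
at `1`, which corresponds to `x`. As `N` lies in `W`, they are equal. -/
lemma full_resFunctor [IsNoetherianRing A] [IsNoetherianRing (h.algebraUnder K).B]
    (hW : IsWide W) [W.IsClosedUnderIsomorphisms] :
    (h.algebraUnder K).resFunctor.Full where
  map_surjective {M N} g := by
    let R := h.algebraUnder K
    let g' : M →+ N := g.hom.hom.toAddMonoidHom
    have hg' (a : A) (m : M) : g' (R.hom a • m) = R.hom a • g' m := g.hom.hom.map_smul a m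
    have hN : W (R.resFunctor.obj N) := by
      rw [← h.essImage_eq (K := K) hW]
      exact R.resFunctor.obj_mem_essImage N
    have key (b : R.B) (m : M) : g' (b • m) = b • g' m := by
      let f₁ := (R.resFunctor.map (fgHom (LinearMap.toSpanSingleton R.B M m) : regular R.B ⟶ M)) ≫ g
      let f₂ := R.resFunctor.map
        (fgHom (LinearMap.toSpanSingleton R.B N (g' m)) : regular R.B ⟶ N)
      have h₁ : f₁.hom.hom.comp (h.regularEquiv K).symm.toLinearMap =
          f₂.hom.hom.comp (h.regularEquiv K).symm.toLinearMap := by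
        refine h.hom_ext hN ?_
        have hx : (h.regularEquiv K).symm x = (1 : R.B) :=
          (h.regularEquiv K).symm_apply_apply (1 : R.B)
        refine (congrArg f₁.hom.hom hx).trans (Eq.trans ?_ (congrArg f₂.hom.hom hx).symm)
        change g' ((1 : R.B) • m) = (1 : R.B) • g' m
        rw [one_smul, one_smul]
      have h₂ : f₁.hom.hom b = f₂.hom.hom b := by
        have hb := (h.regularEquiv K).symm_apply_apply b
        exact (congrArg f₁.hom.hom hb).symm.trans
          ((congr($h₁ (h.regularEquiv K b))).trans (congrArg f₂.hom.hom hb))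
      exact h₂
    exact ⟨fgHom { g' with map_smul' := key }, rfl⟩

end IsFreeOn

/-- Every functorially finite wide subcategory is the essential image of the restriction functor
along a ring epimorphism. -/
lemma exists_isRingEpi_essImage_eq [IsNoetherianRing A] (K : Type u) [Field K] [Algebra K A]
    [Module.Finite K A] {W : ObjectProperty (FGModuleCat.{u} A)}
    (hW : IsFunctoriallyFinite W) (hW' : IsWide W) :
    ∃ R : AlgebraUnder K A, R.IsRingEpi ∧ R.resFunctor.essImage = W := by
  obtain ⟨X, x, h⟩ := exists_isFreeOn K hW hW'.kernels
  have := hW'.kernels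
  have := IsNoetherianRing.of_finite K (h.algebraUnder K).B
  -- An object isomorphic to `X` is a kernel of `0 : X ⟶ X`.
  have : W.IsClosedUnderIsomorphisms := ⟨fun {X Y} e hX =>
    W.prop_of_isLimit_kernelFork (f := (0 : X ⟶ X))
      (k := KernelFork.ofι e.inv (by simp)) (KernelFork.IsLimit.ofι' _ _
        (fun k _ => ⟨k ≫ e.hom, by simp⟩)) hX hX⟩
  exact ⟨h.algebraUnder K, (h.algebraUnder K).isRingEpi_of_full (h.full_resFunctor hW'),
    h.essImage_eq hW'⟩

end EndAlgebra


/-! ### `Ext` and derived functors through projective resolutions -/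

section ExtResolution

open Abelian

universe w

variable {C : Type*} [Category* C] [Abelian C] [HasExt.{w} C] {X : C}

lemma ext_succ_eq_zero_iff (P : ProjectiveResolution X) (Y : C) (n : ℕ) :
    (∀ e : Ext.{w} X Y (n + 1), e = 0) ↔
      ∀ f : P.complex.X (n + 1) ⟶ Y, P.complex.d (n + 2) (n + 1) ≫ f = 0 →
        ∃ g : P.complex.X n ⟶ Y, P.complex.d (n + 1) n ≫ g = f := by
  constructor
  · intro h f hf
    exact (P.extMk_eq_zero_iff f (n + 2) rfl hf n rfl).1 (h _)
  · intro h e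
    obtain ⟨f, hf, rfl⟩ := P.extMk_surjective e (n + 2) rfl
    exact (P.extMk_eq_zero_iff f (n + 2) rfl hf n rfl).2 (h f hf)

end ExtResolution

section MapResolution

variable {C D : Type*} [Category* C] [Category* D] [Abelian C] [Abelian D]

/-- The image of a projective resolution under an exact functor preserving projective objects. -/
def mapProjectiveResolution (F : C ⥤ D) [F.Additive] [PreservesFiniteLimits F]
    [PreservesFiniteColimits F] {X : C} (P : ProjectiveResolution X)
    (hF : ∀ Q : C, Projective Q → Projective (F.obj Q)) : ProjectiveResolution (F.obj X) where
  complex := (F.mapHomologicalComplex _).obj P.complex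
  projective n := hF _ (P.projective n)
  π := (F.mapHomologicalComplex _).map P.π ≫
    ((HomologicalComplex.singleMapHomologicalComplex F _ 0).app X).hom
  quasiIso := by
    have := P.quasiIso
    infer_instance

lemma isZero_leftDerived_succ_iff (G : C ⥤ D) [G.Additive] [EnoughProjectives C] {X : C}
    (P : ProjectiveResolution X) (n : ℕ) :
    IsZero ((G.leftDerived (n + 1)).obj X) ↔
      (ShortComplex.mk (G.map (P.complex.d (n + 2) (n + 1))) (G.map (P.complex.d (n + 1) n))
        (by rw [← G.map_comp, P.complex.d_comp_d, G.map_zero])).Exact := by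
  rw [(P.isoLeftDerivedObj G (n + 1)).isZero_iff]
  refine (HomologicalComplex.exactAt_iff_isZero_homology _ _).symm.trans ?_
  exact HomologicalComplex.exactAt_iff' _ (n + 2) (n + 1) n (by simp) (by simp)

end MapResolution

section Linear

/-- Exactness of `Hom_K(-, U)`: a linear section of `g` over its range is extended to `W` and
composed with `φ`. -/
lemma exists_comp_eq_of_ker_le {K V W U : Type*} [Field K] [AddCommGroup V] [AddCommGroup W]
    [AddCommGroup U] [Module K V] [Module K W] [Module K U] (g : V →ₗ[K] W) (φ : V →ₗ[K] U)
    (h : LinearMap.ker g ≤ LinearMap.ker φ) : ∃ θ : W →ₗ[K] U, θ.comp g = φ := by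
  obtain ⟨s, hs⟩ := g.rangeRestrict.exists_rightInverse_of_surjective g.range_rangeRestrict
  obtain ⟨t, ht⟩ := LinearMap.exists_extend s
  refine ⟨φ.comp t, LinearMap.ext fun v => ?_⟩
  have h₁ : t (g v) = s (g.rangeRestrict v) := congr($ht (g.rangeRestrict v))
  have h₂ : g (s (g.rangeRestrict v)) = g v := congr(($hs (g.rangeRestrict v)).1)
  have h₃ : s (g.rangeRestrict v) - v ∈ LinearMap.ker g := by
    rw [LinearMap.mem_ker, map_sub, h₂, sub_self]
  have h₄ := LinearMap.mem_ker.1 (h h₃)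
  rw [map_sub, sub_eq_zero] at h₄
  simpa [h₁] using h₄

end Linear

/-! ### Duality between `Tor` and `Ext` -/

namespace AlgebraUnder

variable {K A : Type u} [Field K] [Ring A] [Algebra K A] (R : AlgebraUnder K A)

/-- The tensor product `B ⊗_A X`. -/
abbrev Tensor (X : FGModuleCat.{u} A) : Type u := BalancedTensor A R.rightModule X

/-- The pure tensors in `B ⊗_A X`. -/
def tmul {X : FGModuleCat.{u} A} (b : R.B) (x : X) : R.Tensor X :=
  QuotientAddGroup.mk ((b : R.rightModule) ⊗ₜ[ℤ] x)

variable {R} in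
lemma tensor_hom_ext {X : FGModuleCat.{u} A} {V : Type*} [AddCommGroup V] {φ ψ : R.Tensor X →+ V}
    (h : ∀ b x, φ (R.tmul b x) = ψ (R.tmul b x)) : φ = ψ :=
  BalancedTensor.hom_ext h

lemma tmul_add {X : FGModuleCat.{u} A} (b : R.B) (x y : X) :
    R.tmul b (x + y) = R.tmul b x + R.tmul b y := by
  let b' : R.rightModule := b
  exact congrArg (QuotientAddGroup.mk (s := balancedRel A R.rightModule X))
    (TensorProduct.tmul_add (R := ℤ) b' x y)

lemma add_tmul {X : FGModuleCat.{u} A} (b c : R.B) (x : X) :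
    R.tmul (b + c) x = R.tmul b x + R.tmul c x := by
  let b' : R.rightModule := b
  let c' : R.rightModule := c
  exact congrArg (QuotientAddGroup.mk (s := balancedRel A R.rightModule X))
    (TensorProduct.add_tmul (R := ℤ) b' c' x)

lemma mul_tmul {X : FGModuleCat.{u} A} (b : R.B) (a : A) (x : X) :
    R.tmul (b * R.hom a) x = R.tmul b (a • x) := by
  let b' : R.rightModule := b
  have : (MulOpposite.op a • b') ⊗ₜ[ℤ] x - b' ⊗ₜ[ℤ] (a • x) ∈ balancedRel A R.rightModule X :=
    AddSubgroup.subset_closure ⟨b', a, x, rfl⟩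
  exact QuotientAddGroup.eq_iff_sub_mem.2 this

/-- The map `B ⊗_A X → B ⊗_A Y` induced by a morphism `X → Y`. -/
abbrev tensorMap {X Y : FGModuleCat.{u} A} (f : X ⟶ Y) : R.Tensor X →+ R.Tensor Y :=
  BalancedTensor.map R.rightModule f.hom.hom

/-- The additive map out of `B ⊗_A X` induced by a balanced biadditive map. -/
def tensorLift {X : FGModuleCat.{u} A} {V : Type u} [AddCommGroup V] (f : R.B →+ X →+ V)
    (hf : ∀ b a x, f (b * R.hom a) x = f b (a • x)) : R.Tensor X →+ V :=
  let f' : R.rightModule →+ X →+ V := f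
  let β : R.rightModule →ₗ[ℤ] X →ₗ[ℤ] V := AddMonoidHom.toIntLinearMap
    ((AddMonoidHom.mk' (fun g : X →+ V => g.toIntLinearMap) (fun _ _ => rfl)).comp f')
  QuotientAddGroup.lift _ (TensorProduct.lift β).toAddMonoidHom (by
    rw [balancedRel, AddSubgroup.closure_le]
    rintro _ ⟨b, a, x, rfl⟩
    refine AddMonoidHom.mem_ker.2 ((map_sub (TensorProduct.lift β).toAddMonoidHom _ _).trans
      (sub_eq_zero.2 ?_))
    exact hf b a x)

/-- The `K`-module structure on `B ⊗_A X`. -/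
instance tensorModule (X : FGModuleCat.{u} A) : Module K (R.Tensor X) where
  smul k t := R.tensorMap (scalarEnd K k X) t
  one_smul t := by
    change R.tensorMap (scalarEnd K 1 X) t = t
    refine congr($(tensor_hom_ext (φ := R.tensorMap (scalarEnd K 1 X)) (ψ := AddMonoidHom.id _)
      fun b x => ?_) t)
    change R.tmul b (algebraMap K A 1 • x) = _
    rw [map_one, one_smul]; rfl
  mul_smul k l t := by
    refine congr($(tensor_hom_ext (φ := R.tensorMap (scalarEnd K (k * l) X))
      (ψ := (R.tensorMap (scalarEnd K k X)).comp (R.tensorMap (scalarEnd K l X)))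
      fun b x => ?_) t)
    change R.tmul b (algebraMap K A (k * l) • x) = R.tmul b (algebraMap K A k • algebraMap K A l • x)
    rw [map_mul, mul_smul]
  smul_zero k := map_zero _
  smul_add k := map_add _
  add_smul k l t := by
    refine congr($(tensor_hom_ext (φ := R.tensorMap (scalarEnd K (k + l) X))
      (ψ := R.tensorMap (scalarEnd K k X) + R.tensorMap (scalarEnd K l X))
      fun b x => ?_) t)
    change R.tmul b (algebraMap K A (k + l) • x) =
      R.tmul b (algebraMap K A k • x) + R.tmul b (algebraMap K A l • x)
    rw [map_add, add_smul, tmul_add]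
  zero_smul t := by
    refine congr($(tensor_hom_ext (φ := R.tensorMap (scalarEnd K 0 X)) (ψ := 0)
      fun b x => ?_) t)
    change R.tmul b (algebraMap K A 0 • x) = 0
    rw [← mul_tmul, map_zero, map_zero, mul_zero]
    exact (AddMonoidHom.mk' (fun c => R.tmul c x) (fun b c => R.add_tmul b c x)).map_zero

/-- Scalars act through the right factor by definition; they pass to `B` because the image of `K` in
`B` is central. -/
lemma smul_tmul (k : K) {X : FGModuleCat.{u} A} (b : R.B) (x : X) :
    k • R.tmul b x = R.tmul (k • b) x := by
  change R.tmul b (algebraMap K A k • x) = _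
  rw [← mul_tmul, R.hom.commutes, ← Algebra.commutes, Algebra.smul_def]

/-- The map `B ⊗_A X → B ⊗_A Y` as a `K`-linear map. -/
def tensorMapₗ {X Y : FGModuleCat.{u} A} (f : X ⟶ Y) : R.Tensor X →ₗ[K] R.Tensor Y :=
  { R.tensorMap f with
    map_smul' := fun k t => by
      refine congr($(tensor_hom_ext
        (φ := (R.tensorMap f).comp (R.tensorMap (scalarEnd K k X)))
        (ψ := (R.tensorMap (scalarEnd K k Y)).comp (R.tensorMap f)) fun b x => ?_) t)
      exact congrArg (R.tmul b) (map_smul f.hom.hom (algebraMap K A k) x) }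

section Adjunction

variable {V : Type u} [AddCommGroup V] [Module K V] [Module.Finite K V] {X : FGModuleCat.{u} A}

/-- The map `Hom_K(B ⊗_A X, V) → Hom_A(X, Hom_K(B, V))`. -/
def ofTensorDual (φ : R.Tensor X →ₗ[K] V) : X ⟶ R.resFunctor.obj (coinduced K R.B V) :=
  fgHom (Y := R.resFunctor.obj (coinduced K R.B V))
    { toFun := fun x => (
        { toFun := fun b => φ (R.tmul b x)
          map_add' := fun b c => by rw [add_tmul, map_add]
          map_smul' := fun k b => by rw [← smul_tmul, map_smul]; rfl } : R.B →ₗ[K] V)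
      map_add' := fun x y => Coinduced.ext fun b => by
        change φ (R.tmul b (x + y)) = φ (R.tmul b x) + φ (R.tmul b y)
        rw [tmul_add, map_add]
      map_smul' := fun a x => Coinduced.ext fun b => by
        change φ (R.tmul b (a • x)) = φ (R.tmul (b * R.hom a) x)
        rw [mul_tmul] }

/-- The map `Hom_A(X, Hom_K(B, V)) → Hom_K(B ⊗_A X, V)`. -/
def toTensorDual (f : X ⟶ R.resFunctor.obj (coinduced K R.B V)) : R.Tensor X →ₗ[K] V :=
  let f' : X →+ Coinduced K R.B V := f.hom.hom.toAddMonoidHom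
  have hf' (a : A) (x : X) : f' (a • x) = R.hom a • f' x := f.hom.hom.map_smul a x
  let g : R.Tensor X →+ V := R.tensorLift
    { toFun := fun b =>
        { toFun := fun x => f' x b
          map_zero' := by rw [map_zero]; rfl
          map_add' := fun x y => by rw [map_add]; rfl }
      map_zero' := by ext x; exact map_zero (f' x)
      map_add' := fun b c => by ext x; exact map_add (f' x) b c }
    (fun b a x => by
      change f' x (b * R.hom a) = f' (a • x) b
      rw [hf', Coinduced.smul_apply])
  { g with
    map_smul' := fun k t => by
      refine congr($(tensor_hom_ext (φ := g.comp (R.tensorMap (scalarEnd K k X)))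
        (ψ := (DistribSMul.toAddMonoidHom V k).comp g) fun b x => ?_) t)
      change f' (algebraMap K A k • x) b = k • f' x b
      rw [hf', Coinduced.smul_apply, R.hom.commutes, ← Algebra.commutes, ← Algebra.smul_def,
        map_smul] }

lemma ofTensorDual_toTensorDual (f : X ⟶ R.resFunctor.obj (coinduced K R.B V)) :
    R.ofTensorDual (R.toTensorDual f) = f :=
  fgHom_ext fun _ => Coinduced.ext fun _ => rfl

lemma toTensorDual_ofTensorDual (φ : R.Tensor X →ₗ[K] V) :
    R.toTensorDual (R.ofTensorDual φ) = φ :=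
  LinearMap.toAddMonoidHom_injective (tensor_hom_ext fun _ _ => rfl)

lemma toTensorDual_comp {Y : FGModuleCat.{u} A} (d : Y ⟶ X)
    (f : X ⟶ R.resFunctor.obj (coinduced K R.B V)) :
    R.toTensorDual (d ≫ f) = (R.toTensorDual f).comp (R.tensorMapₗ d) :=
  LinearMap.toAddMonoidHom_injective (tensor_hom_ext fun _ _ => rfl)

lemma toTensorDual_zero : R.toTensorDual (0 : X ⟶ R.resFunctor.obj (coinduced K R.B V)) = 0 :=
  LinearMap.toAddMonoidHom_injective (tensor_hom_ext fun _ _ => rfl)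

end Adjunction

section Exactness

variable {X₁ X₂ X₃ : FGModuleCat.{u} A} (d₁ : X₁ ⟶ X₂) (d₂ : X₂ ⟶ X₃)

/-- By adjunction `f` is a linear map on `B ⊗ X₂` vanishing on the image of `d₁`, hence on the
kernel of `d₂`, so it factors through `B ⊗ X₃`. -/
lemma exists_lift_of_tensor_exact
    (h : ∀ t : R.Tensor X₂, R.tensorMap d₂ t = 0 → ∃ s, R.tensorMap d₁ s = t)
    (V : Type u) [AddCommGroup V] [Module K V] [Module.Finite K V]
    (f : X₂ ⟶ R.resFunctor.obj (coinduced K R.B V)) (hf : d₁ ≫ f = 0) : ∃ g, d₂ ≫ g = f := by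
  obtain ⟨θ, hθ⟩ := exists_comp_eq_of_ker_le (R.tensorMapₗ d₂) (R.toTensorDual f) (by
    intro t ht
    obtain ⟨s, rfl⟩ := h t ht
    have := R.toTensorDual_comp d₁ f
    rw [hf, toTensorDual_zero] at this
    exact congr($this s).symm)
  refine ⟨R.ofTensorDual θ, ?_⟩
  rw [← R.ofTensorDual_toTensorDual (d₂ ≫ R.ofTensorDual θ), toTensorDual_comp,
    toTensorDual_ofTensorDual, hθ, ofTensorDual_toTensorDual]

/-- An element `t` of the kernel outside the image is separated from the image by a functional `φ`.
Its adjoint kills `d₁` but cannot factor through `d₂`, since then `φ t = 0`. -/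
lemma tensor_exact_of_exists_lift
    (h : ∀ f : X₂ ⟶ R.resFunctor.obj (coinduced K R.B K), d₁ ≫ f = 0 → ∃ g, d₂ ≫ g = f)
    (t : R.Tensor X₂) (ht : R.tensorMap d₂ t = 0) : ∃ s, R.tensorMap d₁ s = t := by
  by_contra hs
  have hs' : t ∉ LinearMap.range (R.tensorMapₗ d₁) := hs
  obtain ⟨φ, hφ, hφ'⟩ := Submodule.exists_le_ker_of_notMem hs'
  obtain ⟨g, hg⟩ := h (R.ofTensorDual φ) (by
    rw [← R.ofTensorDual_toTensorDual (d₁ ≫ _), toTensorDual_comp, toTensorDual_ofTensorDual,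
      show φ.comp (R.tensorMapₗ d₁) = 0 from LinearMap.range_le_ker_iff.1 hφ']
    exact fgHom_ext fun _ => Coinduced.ext fun _ => rfl)
  apply hφ
  rw [← R.toTensorDual_ofTensorDual φ, ← hg, toTensorDual_comp]
  refine (congrArg (R.toTensorDual g) ht).trans (map_zero _)

end Exactness

section Tor

lemma projective_forget_obj (P : FGModuleCat.{u} A) (hP : Projective P) :
    Projective ((forget₂ (FGModuleCat.{u} A) (ModuleCat.{u} A)).obj P) := by
  have := module_projective_of_projective P
  exact (IsProjective.iff_projective (R := A) P).1 this

instance : R.resFunctor.Additive where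
  map_add := rfl

variable [IsNoetherianRing A]

lemma torVanishes_succ_iff_exact (P : ProjectiveResolution (R.resFunctor.obj (regular R.B)))
    (n : ℕ) : R.TorVanishes (n + 1) ↔ ∀ t : R.Tensor (P.complex.X (n + 1)),
      R.tensorMap (P.complex.d (n + 1) n) t = 0 →
        ∃ s, R.tensorMap (P.complex.d (n + 2) (n + 1)) s = t := by
  have : (forget₂ (FGModuleCat.{u} A) (ModuleCat.{u} A)).Additive := ⟨rfl⟩
  refine (isZero_leftDerived_succ_iff (tensorFunctor R.rightModule)
    (mapProjectiveResolution (forget₂ (FGModuleCat.{u} A) (ModuleCat.{u} A)) P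
      projective_forget_obj) n).trans ?_
  rw [ShortComplex.ab_exact_iff]
  rfl

open Abelian in
-- Exactness of `B ⊗ P` gives vanishing for the pairs `(B, Hom_K(B, V))`. An injective is a retract
-- of some `Hom_K(B, V)`, and the identity of a projective is a sum of maps through `B`.
lemma extVanishes_succ_of_torVanishes (n : ℕ) (h : R.TorVanishes (n + 1)) :
    ExtVanishes R.resFunctor (n + 1) := by
  let _ := HasExt.standard (FGModuleCat.{u} A)
  let P := ProjectiveResolution.of (R.resFunctor.obj (regular R.B))
  rw [R.torVanishes_succ_iff_exact P] at h
  intro Q I hQ hI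
  have h₁ (e : Ext (R.resFunctor.obj (regular R.B)) (R.resFunctor.obj I) (n + 1)) : e = 0 := by
    obtain ⟨V, _, _, _, f, hf⟩ := exists_mono_coinduced K I
    have hV := (ext_succ_eq_zero_iff P (R.resFunctor.obj (coinduced K R.B V)) n).2
      (R.exists_lift_of_tensor_exact _ _ h V) (e.comp (Ext.mk₀ (R.resFunctor.map f)) (add_zero _))
    have : e = (e.comp (Ext.mk₀ (R.resFunctor.map f)) (add_zero _)).comp
        (Ext.mk₀ (R.resFunctor.map (Injective.factorThru (𝟙 I) f))) (add_zero _) := by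
      rw [Ext.comp_assoc_of_third_deg_zero, Ext.mk₀_comp_mk₀, ← Functor.map_comp,
        Injective.comp_factorThru, R.resFunctor.map_id, Ext.comp_mk₀_id]
    rw [this, hV, Ext.zero_comp]
  intro e
  obtain ⟨m, α, β, hαβ⟩ := exists_dual_basis Q
  rw [← Ext.mk₀_id_comp e, ← R.resFunctor.map_id, hαβ, Functor.map_sum, Ext.mk₀_sum, Ext.sum_comp]
  refine Finset.sum_eq_zero fun i _ => ?_
  rw [Functor.map_comp, ← Ext.mk₀_comp_mk₀, Ext.comp_assoc_of_second_deg_zero,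
    h₁ ((Ext.mk₀ _).comp e _), Ext.comp_zero]

/-- The single pair `(B, Hom_K(B, K))` suffices. -/
lemma torVanishes_succ_of_extVanishes [IsNoetherianRing R.B] (n : ℕ) (h : ExtVanishes R.resFunctor (n + 1)) :
    R.TorVanishes (n + 1) := by
  let P := ProjectiveResolution.of (R.resFunctor.obj (regular R.B))
  rw [R.torVanishes_succ_iff_exact P]
  let _ := HasExt.standard (FGModuleCat.{u} A)
  refine R.tensor_exact_of_exists_lift _ _ ?_
  exact (ext_succ_eq_zero_iff P _ n).1 (h _ _ inferInstance inferInstance)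

end Tor

end AlgebraUnder


/-! ### The correspondences -/

variable {K A : Type u} [Field K] [Ring A] [Algebra K A]

namespace ModFunctor

omit [Algebra K A] in
-- Both functors are equivalences onto the common image; compose one with a quasi-inverse of the
-- other.
lemma equivalent_of_isFullyFaithfulExact [IsNoetherianRing A] {E E' : ModFunctor K A}
    [IsNoetherianRing E.B] [IsNoetherianRing E'.B]
    (hE : IsFullyFaithfulExact E.functor) (hE' : IsFullyFaithfulExact E'.functor)
    (h : E.functor.essImage = E'.functor.essImage) : E.Equivalent E' := by
  have := hE.full
  have := hE.faithful
  have := hE'.full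
  have := hE'.faithful
  let L : FGModuleCat.{u} E.B ⥤ E'.functor.EssImageSubcategory :=
    E'.functor.essImage.lift E.functor fun X => h.le _ (E.functor.obj_mem_essImage X)
  have : L.EssSurj := ⟨fun Y => by
    obtain ⟨X, ⟨e⟩⟩ : E.functor.essImage Y.obj := h.ge _ Y.property
    exact ⟨X, ⟨E'.functor.essImage.isoMk e⟩⟩⟩
  have : L.IsEquivalence := { }
  let G := L.asEquivalence.trans E'.functor.toEssImage.asEquivalence.symm
  let e : G.functor ⋙ E'.functor.toEssImage ≅ L := Functor.associator _ _ _ ≪≫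
    Functor.isoWhiskerLeft L E'.functor.toEssImage.asEquivalence.counitIso ≪≫ L.rightUnitor
  exact ⟨G, ⟨Functor.isoWhiskerLeft G.functor E'.functor.toEssImageCompι.symm ≪≫
    (Functor.associator _ _ _).symm ≪≫ Functor.isoWhiskerRight e E'.functor.essImage.ι⟩⟩

omit [Algebra K A] in
lemma essImage_eq_of_equivalent {E E' : ModFunctor K A} (h : E.Equivalent E') :
    E.functor.essImage = E'.functor.essImage :=
  congrArg (imageMap K A) (Quotient.sound h)

variable [Module.Finite K A] [IsNoetherianRing A] (E : ModFunctor K A) [IsNoetherianRing E.B]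

lemma isWeaklyHomological_iff :
    E.IsWeaklyHomological ↔ IsFullyFaithfulExact E.functor ∧ ExtVanishes E.functor 1 := by
  have := fg_enoughInjectives K (B := E.B)
  exact isWeaklyHomologicalEmbedding_iff

lemma isHomological_iff : E.IsHomological ↔
    IsFullyFaithfulExact E.functor ∧ ∀ i, 0 < i → ExtVanishes E.functor i := by
  have := fg_enoughInjectives K (B := E.B)
  exact isHomologicalEmbedding_iff

end ModFunctor

namespace AlgebraUnder

lemma torVanishes_iff_extVanishes (R : AlgebraUnder K A) [IsNoetherianRing A]
    [IsNoetherianRing R.B] {i : ℕ} (hi : 0 < i) :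
    R.TorVanishes i ↔ ExtVanishes R.resFunctor i := by
  obtain ⟨n, rfl⟩ := Nat.exists_eq_succ_of_ne_zero hi.ne'
  exact ⟨R.extVanishes_succ_of_torVanishes n, R.torVanishes_succ_of_extVanishes n⟩

variable [Module.Finite K A] (R : AlgebraUnder K A)

lemma isWeaklyHomological_restriction_iff :
    R.restriction.IsWeaklyHomological ↔ R.IsRingEpi ∧ R.TorVanishes 1 := by
  have := IsNoetherianRing.of_finite K A
  have : IsNoetherianRing R.B := IsNoetherianRing.of_finite K R.B
  have : IsNoetherianRing R.restriction.B := this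
  rw [ModFunctor.isWeaklyHomological_iff, R.torVanishes_iff_extVanishes one_pos,
    ← R.isFullyFaithfulExact_restriction_iff]
  rfl

lemma isHomological_restriction_iff :
    R.restriction.IsHomological ↔ R.IsRingEpi ∧ ∀ i : ℕ, 0 < i → R.TorVanishes i := by
  have := IsNoetherianRing.of_finite K A
  have : IsNoetherianRing R.B := IsNoetherianRing.of_finite K R.B
  have : IsNoetherianRing R.restriction.B := this
  rw [ModFunctor.isHomological_iff, ← R.isFullyFaithfulExact_restriction_iff]
  exact and_congr_right fun _ => forall₂_congr fun i hi => (R.torVanishes_iff_extVanishes hi).symm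

end AlgebraUnder

variable [Module.Finite K A]

namespace ModFunctor

lemma IsHomological.isWeaklyHomological {E : ModFunctor K A} (h : E.IsHomological) :
    E.IsWeaklyHomological := by
  obtain ⟨h, h'⟩ := h
  exact ⟨h, h' 1 one_pos⟩

lemma IsWeaklyHomological.functoriallyFiniteWide {E : ModFunctor K A}
    (h : E.IsWeaklyHomological) : E.functor.essImage ∈ functoriallyFiniteWide A := by
  have := IsNoetherianRing.of_finite K A
  have := IsNoetherianRing.of_finite K E.B
  obtain ⟨h, h'⟩ := E.isWeaklyHomological_iff.1 h
  exact ⟨h.essImage_isFunctoriallyFinite K, h.isWide_essImage K h'⟩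

/-- Weakly homological embeddings with the same essential image are equivalent. -/
lemma IsWeaklyHomological.equivalent {E E' : ModFunctor K A} (h : E.IsWeaklyHomological)
    (h' : E'.IsWeaklyHomological) (hEE' : E.functor.essImage = E'.functor.essImage) :
    E.Equivalent E' := by
  have := IsNoetherianRing.of_finite K A
  have := IsNoetherianRing.of_finite K E.B
  have := IsNoetherianRing.of_finite K E'.B
  exact equivalent_of_isFullyFaithfulExact (E.isWeaklyHomological_iff.1 h).1
    (E'.isWeaklyHomological_iff.1 h').1 hEE'

/-- Needed for surjectivity in the homological case: the ring epimorphism supplied by the weak case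
represents the same class, and all higher vanishing must pass to it. -/
lemma IsHomological.of_equivalent {E E' : ModFunctor K A} (h : E.Equivalent E')
    (hE' : E'.IsHomological) : E.IsHomological := by
  have := IsNoetherianRing.of_finite K A
  have := IsNoetherianRing.of_finite K E.B
  have := IsNoetherianRing.of_finite K E'.B
  obtain ⟨h₁, h₂⟩ := E'.isHomological_iff.1 hE'
  obtain ⟨G, ⟨e⟩⟩ := h
  exact E.isHomological_iff.2 ⟨h₁.of_equivalence G e, fun i hi => (h₂ i hi).of_equivalence G e⟩

end ModFunctor

/-- Every functorially finite wide subcategory is the essential image of the restriction functor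
along a ring epimorphism with vanishing `Tor_1`. -/
lemma exists_isWeaklyHomological_restriction {W : ObjectProperty (FGModuleCat.{u} A)}
    (hW : W ∈ functoriallyFiniteWide A) : ∃ R : AlgebraUnder K A,
      R.restriction.IsWeaklyHomological ∧ R.restriction.functor.essImage = W := by
  have := IsNoetherianRing.of_finite K A
  obtain ⟨R, hR, h⟩ := exists_isRingEpi_essImage_eq K hW.1 hW.2
  have : IsNoetherianRing R.B := IsNoetherianRing.of_finite K R.B
  have : IsNoetherianRing R.restriction.B := this
  have hR' := R.isFullyFaithfulExact_restriction_iff.2 hR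
  exact ⟨R, R.restriction.isWeaklyHomological_iff.2
    ⟨hR', hR'.extVanishes_one (h ▸ hW.2.extensions)⟩, h⟩

/-- Every weakly homological embedding is equivalent to the restriction functor along a
homomorphism of algebras. -/
lemma ModFunctor.IsWeaklyHomological.exists_restriction_equivalent {E : ModFunctor K A}
    (hE : E.IsWeaklyHomological) : ∃ R : AlgebraUnder K A,
      R.restriction.IsWeaklyHomological ∧ R.restriction.Equivalent E := by
  obtain ⟨R, hR, h⟩ := exists_isWeaklyHomological_restriction (K := K) hE.functoriallyFiniteWide
  exact ⟨R, hR, hR.equivalent hE h⟩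

variable (K A) in
lemma bijOn_imageMap :
    Set.BijOn (imageMap K A) (weaklyHomologicalClasses K A) (functoriallyFiniteWide A) := by
  refine ⟨?_, ?_, ?_⟩
  · rintro _ ⟨E, hE, rfl⟩
    exact hE.functoriallyFiniteWide
  · rintro _ ⟨E, hE, rfl⟩ _ ⟨E', hE', rfl⟩ h
    exact Quotient.sound (hE.equivalent hE' h)
  · intro W hW
    obtain ⟨R, hR, h⟩ := exists_isWeaklyHomological_restriction (K := K) hW
    exact ⟨_, ⟨R.restriction, hR, rfl⟩, h⟩

variable (K A) in
-- The essential image is an invariant of the class of a functor and determines the ring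
-- epimorphism, which gives injectivity.
lemma bijOn_restrictionMap :
    Set.BijOn (restrictionMap K A) (torOneRingEpiClasses K A) (weaklyHomologicalClasses K A) := by
  refine ⟨?_, ?_, ?_⟩
  · rintro _ ⟨R, hR, rfl⟩
    exact ⟨R.restriction, R.isWeaklyHomological_restriction_iff.2 hR, rfl⟩
  · rintro _ ⟨R, hR, rfl⟩ _ ⟨R', hR', rfl⟩ h
    exact Quotient.sound (AlgebraUnder.equivalent_of_essImage_eq hR.1 hR'.1
      (ModFunctor.essImage_eq_of_equivalent (Quotient.exact h)))
  · rintro _ ⟨E, hE, rfl⟩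
    obtain ⟨R, hR, h⟩ := hE.exists_restriction_equivalent
    exact ⟨_, ⟨R, R.isWeaklyHomological_restriction_iff.1 hR, rfl⟩, Quotient.sound h⟩

variable (K A) in
lemma bijOn_restrictionMap_homological :
    Set.BijOn (restrictionMap K A) (homologicalRingEpiClasses K A) (homologicalClasses K A) := by
  refine ⟨?_, ?_, ?_⟩
  · rintro _ ⟨R, hR, rfl⟩
    exact ⟨R.restriction, R.isHomological_restriction_iff.2 hR, rfl⟩
  · refine (bijOn_restrictionMap K A).injOn.mono ?_
    rintro _ ⟨R, hR, rfl⟩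
    exact ⟨R, ⟨hR.1, hR.2 1 one_pos⟩, rfl⟩
  · rintro _ ⟨E, hE, rfl⟩
    obtain ⟨R, hR, h⟩ := hE.isWeaklyHomological.exists_restriction_equivalent
    exact ⟨_, ⟨R, R.isHomological_restriction_iff.1 (.of_equivalent h hE), rfl⟩,
      Quotient.sound h⟩

end ModEmb

end

theorem proposition3p2 (K : Type u) [Field K] [IsAlgClosed K]
    (A : Type u) [Ring A] [Algebra K A] [Module.Finite K A] :
    Set.BijOn (ModEmb.imageMap K A)
      (ModEmb.weaklyHomologicalClasses K A) (ModEmb.functoriallyFiniteWide A) ∧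
    Set.BijOn (ModEmb.restrictionMap K A)
      (ModEmb.torOneRingEpiClasses K A) (ModEmb.weaklyHomologicalClasses K A) ∧
    Set.BijOn (ModEmb.restrictionMap K A)
      (ModEmb.homologicalRingEpiClasses K A) (ModEmb.homologicalClasses K A) :=
  ⟨ModEmb.bijOn_imageMap K A, ModEmb.bijOn_restrictionMap K A,
    ModEmb.bijOn_restrictionMap_homological K A⟩
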